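/- For integers $n\ge 2$ and $p\ge 6$ let $\mathbb U_n(p)$ be the group of upper-triangular $n\times n$ matrices over $\mathbb Z_p=\mathbb Z/p\mathbb Z$ with all diagonal entries equal to $1$. For $1\le i\le n-1$ let $E_{i,i+1}$ be the matrix with a $1$ in entry $(i,i+1)$ and zeros elsewhere, and for $c\in\mathbb Z_p$ let $C_i(c)=\{x(I+cE_{i,i+1})x^{-1}:x\in\mathbb U_n(p)\}$ be the conjugacy class of $I+cE_{i,i+1}$. For a probability distribution $\mu$ on a finite group $G$ let $P(x,y)=\mu(x^{-1}y)$, let $P_t(x,y)=\sum_{k\ge 0}e^{-t}\frac{t^k}{k!}P^k(x,y)$ be the kernel of the continuous-time rate-$1$ walk with jump distribution $\mu$, and let $d(t)=\max_{x\in G}\frac12\sum_{y\in G}\bigl|P_t(x,y)-\frac1{|G|}\bigr|$. A sequence of such walks with distance functions $d_n$ exhibits cutoff at times $t_n$ if there are window sizes $w_n>0$ with $w_n=o(t_n)$ such that $$\lim_{c\to\infty}\liminf_{n\to\infty}d_n(t_n-cw_n)=1\quad\text{and}\quad\lim_{c\to\infty}\limsup_{n\to\infty}d_n(t_n+cw_n)=0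 .$$ Let $p=p_n\ge 6$ be integers, not necessarily prime, that may depend on $n$ in any way. (a) Let $\mu$ be the uniform distribution on $\bigcup_{i=1}^{n-1}\bigl(C_i(1)\cup C_i(-1)\bigr)$, that is, $\mu(x)=\frac{1}{2(n-1)p^{n-2}}$ on this set and $\mu(x)=0$ elsewhere. The walks on $\mathbb U_n(p)$ with jump distribution $\mu$ exhibit cutoff at times $$\frac{(n-1)\log(n-1)}{2\bigl(1-\cos(2\pi/p)\bigr)} .$$ (b) Let $a=\lfloor\sqrt p\rfloor+\mathbf 1\{\lfloor\sqrt p\rfloor\text{ is even}\}$ and $b=\lfloor\sqrt a\rfloor$, and let $\nu$ be the law of the group element obtained by choosing $i$ uniformly from $\{1,\dots,n-1\}$, independently choosing $c$ uniformly from the list $(1,-1,b,-b)$ (repetitions counted), and then choosing a uniform element of $C_i(c)$. (If $1,-1,b,-b$ are distinct in $\mathbb Z_p$ and $b$ is prime to $p$, this is the distribution equal to $\frac{1}{4(n-1)p^{n-2}}$ on $\bigcup_{i=1}^{n-1}\bigl(C_i(1)\cup C_i(-1)\cup C_i(b)\cup C_i(-b)\bigr)$ and to $0$ elsewhere.) The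 walks on $\mathbb U_n(p)$ with jump distribution $\nu$ exhibit cutoff at times $$\frac{(n-1)\log(n-1)}{\bigl(1-\cos(2\pi/p)\bigr)+\bigl(1-\cos(2\pi\lfloor\sqrt a\rfloor/p)\bigr)} .$$ -/

import Mathlib

open Filter Topology

noncomputable section

/-! ### Continuous-time random walks on a finite group -/

/-- Transition matrix of the random walk on `G` with jump distribution `μ`: the current position is
multiplied on the right by a `μ`-distributed element, so `P(x, y) = μ(x⁻¹ y)`. -/
def walkMatrix {G : Type*} [Group G] (μ : G → ℝ) : Matrix G G ℝ :=
  Matrix.of fun x y => μ (x⁻¹ * y)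

open Classical in
/-- Transition kernel at time `t` of the rate-1 continuous-time walk:
`P_t(x, y) = ∑_k e^{-t} t^k / k! P^k(x, y)`. -/
def heatKernel {G : Type*} [Group G] [Fintype G] (μ : G → ℝ) (t : ℝ) (x y : G) : ℝ :=
  ∑' k : ℕ, Real.exp (-t) * t ^ k / (k.factorial : ℝ) * (walkMatrix μ ^ k) x y

/-- Worst-case total variation distance to the uniform distribution at time `t`:
`d(t) = max_x (1/2) ∑_y |P_t(x, y) - 1/|G||`. -/
def tvDist {G : Type*} [Group G] [Fintype G] (μ : G → ℝ) (t : ℝ) : ℝ :=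
  ⨆ x : G, (1 / 2 : ℝ) * ∑ y : G, |heatKernel μ t x y - 1 / (Fintype.card G : ℝ)|

/-- A sequence of chains with distance-to-stationarity functions `d n` exhibits cutoff at times
`t n`: there is a window `w n = o(t n)` such that
`lim_{c → ∞} liminf_n d n (t n - c w n) = 1` and `lim_{c → ∞} limsup_n d n (t n + c w n) = 0`. -/
def ExhibitsCutoff (d : ℕ → ℝ → ℝ) (t : ℕ → ℝ) : Prop :=
  ∃ w : ℕ → ℝ, (∀ n, 0 < w n) ∧ w =o[atTop] t ∧
    Tendsto (fun c : ℝ => liminf (fun n => d n (t n - c * w n)) atTop) atTop (𝓝 1) ∧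
    Tendsto (fun c : ℝ => limsup (fun n => d n (t n + c * w n)) atTop) atTop (𝓝 0)

/-! ### Unit upper-triangular matrices over `ℤ/pℤ` -/

/-- The condition that a square matrix is upper triangular with ones on the diagonal. -/
def IsUnitUpper {n : ℕ} {R : Type*} [CommRing R] (A : Matrix (Fin n) (Fin n) R) : Prop :=
  (∀ i j : Fin n, j < i → A i j = 0) ∧ ∀ i, A i i = 1

theorem IsUnitUpper.det_eq_one {n : ℕ} {R : Type*} [CommRing R] {A : Matrix (Fin n) (Fin n) R}
    (hA : IsUnitUpper A) : A.det = 1 := by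
  have h : A.IsUpperTriangular := fun i j hij => hA.1 i j hij
  rw [Matrix.det_of_isUpperTriangular h]
  simp [hA.2]

theorem IsUnitUpper.mul {n : ℕ} {R : Type*} [CommRing R] {A B : Matrix (Fin n) (Fin n) R}
    (hA : IsUnitUpper A) (hB : IsUnitUpper B) : IsUnitUpper (A * B) := by
  refine ⟨fun i j hij => ?_, fun i => ?_⟩
  · rw [Matrix.mul_apply]
    refine Finset.sum_eq_zero fun k _ => ?_
    rcases lt_or_ge k i with h | h
    · rw [hA.1 i k h, zero_mul]
    · rw [hB.1 k j (lt_of_lt_of_le hij h), mul_zero]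
  · rw [Matrix.mul_apply, Finset.sum_eq_single i]
    · rw [hA.2, hB.2, one_mul]
    · intro k _ hk
      rcases lt_or_gt_of_ne hk with h | h
      · rw [hA.1 i k h, zero_mul]
      · rw [hB.1 k i h, mul_zero]
    · simp

theorem IsUnitUpper.inv {n : ℕ} {R : Type*} [CommRing R] {A : Matrix (Fin n) (Fin n) R}
    (hA : IsUnitUpper A) : IsUnitUpper A⁻¹ := by
  have hdet : IsUnit A.det := by rw [hA.det_eq_one]; exact isUnit_one
  have hlow : ∀ i j : Fin n, j < i → A⁻¹ i j = 0 := by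
    letI := Matrix.invertibleOfIsUnitDet A hdet
    have h : Matrix.BlockTriangular A id := fun i j hij => hA.1 i j hij
    exact fun i j hij => Matrix.blockTriangular_inv_of_blockTriangular h hij
  refine ⟨hlow, fun i => ?_⟩
  have h1 : (A * A⁻¹) i i = 1 := by rw [Matrix.mul_nonsing_inv A hdet]; simp
  rw [Matrix.mul_apply, Finset.sum_eq_single i] at h1
  · rwa [hA.2, one_mul] at h1
  · intro k _ hk
    rcases lt_or_gt_of_ne hk with h | h
    · rw [hA.1 i k h, zero_mul]
    · rw [hlow k i h, mul_zero]
  · simp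

/-- The group of unit upper-triangular `n × n` matrices over `ℤ/pℤ`. -/
def unitUpper (n p : ℕ) : Subgroup (Matrix.SpecialLinearGroup (Fin n) (ZMod p)) where
  carrier := {A | IsUnitUpper (A : Matrix (Fin n) (Fin n) (ZMod p))}
  mul_mem' := by
    intro A B hA hB
    have h := IsUnitUpper.mul hA hB
    simpa using h
  one_mem' := by
    refine ⟨fun i j hij => ?_, fun i => ?_⟩
    · simp [Matrix.one_apply, hij.ne']
    · simp
  inv_mem' := by
    intro A hA
    have h := IsUnitUpper.inv hA
    have e : ((A⁻¹ : Matrix.SpecialLinearGroup (Fin n) (ZMod p)) :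
        Matrix (Fin n) (Fin n) (ZMod p)) = (A : Matrix (Fin n) (Fin n) (ZMod p))⁻¹ := by
      simp [Matrix.inv_def]
    change IsUnitUpper _
    rw [e]
    exact h

instance unitUpperFintype (n p : ℕ) [NeZero p] : Fintype (unitUpper n p) :=
  Fintype.ofFinite _

/-- The matrix `I + c E_{i,i+1}`; the superdiagonal positions are indexed by `i : Fin (n - 1)`. -/
def superdiagMatrix (n p : ℕ) (i : Fin (n - 1)) (c : ZMod p) : Matrix (Fin n) (Fin n) (ZMod p) :=
  1 + Matrix.single ⟨i.1, by omega⟩ ⟨i.1 + 1, by omega⟩ c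

/-- `C_i(c)`: the conjugacy class `{x (I + c E_{i,i+1}) x⁻¹}` in the group of unit upper-triangular
matrices. -/
def superdiagClass (n p : ℕ) (i : Fin (n - 1)) (c : ZMod p) : Set (unitUpper n p) :=
  {y | ∃ x : unitUpper n p, (y.1 : Matrix (Fin n) (Fin n) (ZMod p)) =
    (x.1 : Matrix (Fin n) (Fin n) (ZMod p)) * superdiagMatrix n p i c *
      ((x⁻¹).1 : Matrix (Fin n) (Fin n) (ZMod p))}

/-! ### The two jump distributions -/

open Classical in
/-- The uniform distribution on the union of the classes `C_i(1)` and `C_i(-1)`, `1 ≤ i ≤ n - 1`.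
The union has `2 (n - 1) p ^ (n - 2)` elements (for `n ≥ 2` and `p ≥ 3`). -/
def jumpMu (n p : ℕ) (x : unitUpper n p) : ℝ :=
  if x ∈ ⋃ i : Fin (n - 1), superdiagClass n p i 1 ∪ superdiagClass n p i (-1) then
    1 / (2 * ((n : ℝ) - 1) * (p : ℝ) ^ (n - 2))
  else 0

open Classical in
/-- The uniform distribution on a set `C`, as a function. -/
def unifOn {G : Type*} (C : Set G) (x : G) : ℝ :=
  if x ∈ C then 1 / (C.ncard : ℝ) else 0

/-- `a = ⌊√p⌋ + 1{⌊√p⌋ is even}`. -/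
def oddSqrt (p : ℕ) : ℕ :=
  Nat.sqrt p + if Even (Nat.sqrt p) then 1 else 0

/-- `⌊√a⌋`, where `a = ⌊√p⌋ + 1{⌊√p⌋ is even}`. -/
def jumpSize (p : ℕ) : ℕ :=
  Nat.sqrt (oddSqrt p)

/-- With `b = ⌊√a⌋`: pick `i` uniformly from `1, …, n - 1` and `c` uniformly from the list
`1, -1, b, -b`, then a uniform element of the class `C_i(c)`. If `1, -1, b, -b` are distinct and
`b` is prime to `p`, every class has `p ^ (n - 2)` elements, and this is the function equal to
`1 / (4 (n - 1) p ^ (n - 2))` on the union of these classes and to `0` elsewhere. -/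
def jumpNu (n p : ℕ) (x : unitUpper n p) : ℝ :=
  ∑ i : Fin (n - 1), 1 / (4 * ((n : ℝ) - 1)) *
    (unifOn (superdiagClass n p i 1) x + unifOn (superdiagClass n p i (-1)) x +
      unifOn (superdiagClass n p i (jumpSize p : ZMod p)) x +
      unifOn (superdiagClass n p i (-(jumpSize p : ZMod p))) x)

end

/-! ### Products of commuting exponentials in a Banach algebra -/

section BanachAlgebra

variable {A : Type*} [NormedRing A] [NormedAlgebra ℝ A] [CompleteSpace A]

/-! Let K be the kernel of the superdiagonal homomorphism to (ℤ/p)^(n-1). Total variation distance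
splits into the loss from averaging over K, and the distance to uniformity of the averaged law,
which depends only on the superdiagonal (`tvDist_le_norm_add_sqrt`). Both walks are treated at once
as `signedJumpDist n p b`, with b = 1 in part (a) and b = `jumpSize p` in part (b).

The loss over K is a coupon-collector term. Jump laws are class functions, so their walk operators
commute and the jumps may be rearranged. One jump from C_i(±1) at every position, taken in
decreasing order of i, gives I + UV, with U unit upper triangular and V strictly upper triangular.
Right multiplication by an element of K permutes the parameters of such products, so the product is
already invariant under K (`prod_walkMatrix_signedClassDist_mul`). In continuous time the positions
have independent Poisson clocks, and a union bound over silent positions bounds the loss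
(`norm_exp_list_sum_mul_le`).

On the superdiagonal the walk is a product of n - 1 independent walks on ℤ/p. Fourier analysis
bounds the ℓ² distance by a power of one sum over characters (`card_mul_sum_heatKernel_le`). The gap
of the character k is at least that of the character 1 times a factor growing linearly in k
(`charGap_ge`), so the sum is a geometric series with constants uniform in p (`sum_exp_charGap_le`).
With L the gap at 1, this term becomes small at (n-1)log(n-1)/(2L), with window (n-1)/L. The bounds
L ≤ 1/2 for b = 1 and L ≤ 1/4 for b ≥ 2 ensure that all coupons have been collected by then.

For the lower bound, the sum of the cosines of the superdiagonal entries is an eigenfunction whose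
variance is at most n - 1 both under the walk and under the uniform law. Before the cutoff time its
mean under the walk is much larger than √(n-1), and Chebyshev's inequality separates the two laws
(`le_tvDist_signedJumpDist`). -/

theorem NormedSpace.hasSum_exp_smul (x : A) :
    HasSum (fun k : ℕ => ((k.factorial : ℝ)⁻¹) • x ^ k) (NormedSpace.exp x) :=
  NormedSpace.exp_series_hasSum_exp' (𝕂 := ℝ) x

/-- Factoring x out of the non-constant terms isolates the event of at least one step. The cofactor
is a power series in x, so it inherits every commutation of x. -/
theorem exp_eq_one_add_mul (x : A) : ∃ y : A, NormedSpace.exp x = 1 + x * y ∧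
    ∀ z : A, Commute z x → Commute z y := by
  have hs : Summable fun k : ℕ => (((k + 1).factorial : ℝ)⁻¹) • x ^ k := by
    refine Summable.of_norm_bounded (NormedSpace.norm_expSeries_summable' (𝕂 := ℝ) x) fun k => ?_
    rw [norm_smul, norm_smul]
    refine mul_le_mul_of_nonneg_right ?_ (norm_nonneg _)
    rw [Real.norm_of_nonneg (by positivity), Real.norm_of_nonneg (by positivity)]
    gcongr
    omega
  refine ⟨∑' k : ℕ, (((k + 1).factorial : ℝ)⁻¹) • x ^ k, ?_, fun z hz => ?_⟩
  · rw [NormedSpace.exp_eq_tsum ℝ]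
    simp only
    rw [(NormedSpace.expSeries_summable' (𝕂 := ℝ) x).tsum_eq_zero_add, ← hs.tsum_mul_left]
    simp [pow_succ']
  · exact Commute.tsum_right _ fun k => ((hz.pow_right k).smul_right _)

theorem norm_exp_sub_one_le_exp_norm (x : A) :
    ‖NormedSpace.exp x - 1‖ ≤ Real.exp ‖x‖ - 1 := by
  have h := NormedSpace.hasSum_exp_smul x
  rw [← hasSum_nat_add_iff' 1] at h
  have hr : HasSum (fun k : ℕ => ‖x‖ ^ k / (k.factorial : ℝ)) (Real.exp ‖x‖) := by
    rw [Real.exp_eq_exp_ℝ]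
    exact NormedSpace.expSeries_div_hasSum_exp ‖x‖
  rw [← hasSum_nat_add_iff' 1] at hr
  simp only [Finset.range_one, Finset.sum_singleton, Nat.factorial_zero, Nat.cast_one, inv_one,
    pow_zero, one_smul, div_one] at h hr
  rw [← h.tsum_eq]
  refine tsum_of_norm_bounded hr fun k => ?_
  rw [norm_smul, Real.norm_of_nonneg (by positivity), div_eq_inv_mul]
  gcongr
  exact norm_pow_le' _ (Nat.succ_pos k)

theorem norm_exp_le_exp_norm [NormOneClass A] (x : A) :
    ‖NormedSpace.exp x‖ ≤ Real.exp ‖x‖ := by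
  have h := norm_exp_sub_one_le_exp_norm x
  have h2 := norm_add_le (NormedSpace.exp x - 1) 1
  rw [sub_add_cancel, norm_one] at h2
  linarith

theorem exp_add_of_commute_real {x y : A} (h : Commute x y) :
    NormedSpace.exp (x + y) = NormedSpace.exp x * NormedSpace.exp y := by
  let _ : NormedAlgebra ℚ A := NormedAlgebra.restrictScalars ℚ ℝ A
  exact NormedSpace.exp_add_of_commute h

omit [CompleteSpace A] in
theorem exp_algebraMap_real (c : ℝ) :
    NormedSpace.exp (algebraMap ℝ A c) = Real.exp c • (1 : A) := by
  rw [← NormedSpace.algebraMap_exp_comm, ← Real.exp_eq_exp_ℝ, Algebra.algebraMap_eq_smul_one]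

theorem exp_smul_sub_one (c : ℝ) (m : A) :
    NormedSpace.exp (c • (m - 1)) = Real.exp (-c) • NormedSpace.exp (c • m) := by
  have h : c • (m - 1) = c • m + algebraMap ℝ A (-c) := by
    rw [Algebra.algebraMap_eq_smul_one, smul_sub, neg_smul, sub_eq_add_neg]
  rw [h, exp_add_of_commute_real (Algebra.commutes' _ _).symm, exp_algebraMap_real,
    mul_smul_comm, mul_one]

/-- The exponential is a Poisson(c) mixture of powers of the contraction m. -/
theorem norm_exp_smul_sub_one_le [NormOneClass A] {c : ℝ} (hc : 0 ≤ c) {m : A} (hm : ‖m‖ ≤ 1) :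
    ‖NormedSpace.exp (c • (m - 1))‖ ≤ 1 := by
  rw [exp_smul_sub_one, norm_smul, Real.norm_of_nonneg (Real.exp_pos _).le]
  have h1 : ‖c • m‖ ≤ c := by
    rw [norm_smul, Real.norm_of_nonneg hc]
    exact mul_le_of_le_one_right hc hm
  calc Real.exp (-c) * ‖NormedSpace.exp (c • m)‖
      ≤ Real.exp (-c) * Real.exp c := by
        gcongr
        exact (norm_exp_le_exp_norm _).trans (Real.exp_le_exp.2 h1)
    _ = 1 := by rw [← Real.exp_add]; simp

theorem norm_exp_list_sum_le_one [NormOneClass A] {ι : Type*} (m : ι → A)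
    (hcomm : ∀ i j, Commute (m i) (m j)) (hm : ∀ i, ‖m i‖ ≤ 1) {c : ℝ} (hc : 0 ≤ c)
    (l : List ι) : ‖NormedSpace.exp ((l.map fun i => c • (m i - 1)).sum)‖ ≤ 1 := by
  induction l with
  | nil => simp
  | cons j l ihl =>
    rw [List.map_cons, List.sum_cons, exp_add_of_commute_real]
    · exact (norm_mul_le _ _).trans
        (mul_le_one₀ (norm_exp_smul_sub_one_le hc (hm j)) (norm_nonneg _) ihl)
    · refine Commute.list_sum_right _ _ fun x hx => ?_
      obtain ⟨k, -, rfl⟩ := List.mem_map.1 hx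
      exact (((hcomm j k).sub_right (Commute.one_right _)).sub_left
        (Commute.one_left _)).smul_left c |>.smul_right c

/-- A Poisson number of steps of `m` is zero with probability `e^{-c}`, and otherwise the result
factors through `m`. -/
theorem norm_exp_list_sum_mul_le [NormOneClass A] {ι : Type*} (m : ι → A)
    (hcomm : ∀ i j, Commute (m i) (m j)) (hm : ∀ i, ‖m i‖ ≤ 1) {c : ℝ} (hc : 0 ≤ c)
    (l : List ι) (z : A) (hz : (l.map m).prod * z = 0) :
    ‖NormedSpace.exp ((l.map fun i => c • (m i - 1)).sum) * z‖ ≤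
      l.length * Real.exp (-c) * ‖z‖ := by
  induction l generalizing z with
  | nil =>
    have : z = 0 := by simpa using hz
    simp [this]
  | cons i l ih =>
    obtain ⟨y, hy, hyc⟩ := exp_eq_one_add_mul (c • m i)
    have hcs : ∀ j, Commute (c • (m i - 1)) (c • (m j - 1)) := fun j =>
      (((hcomm i j).sub_right (Commute.one_right _)).sub_left (Commute.one_left _)).smul_left c
        |>.smul_right c
    have hsum : Commute (c • (m i - 1)) ((l.map fun j => c • (m j - 1)).sum) :=
      Commute.list_sum_right _ _ fun x hx => by
        obtain ⟨j, -, rfl⟩ := List.mem_map.1 hx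
        exact hcs j
    have hE : NormedSpace.exp (c • (m i - 1)) =
        Real.exp (-c) • (1 : A) + Real.exp (-c) • (c • m i * y) := by
      rw [exp_smul_sub_one, hy, smul_add]
    set S := (l.map fun j => c • (m j - 1)).sum with hS
    -- The terms of exp(c(m i - 1)) z with at least one factor m i. The product over the tail l
    -- annihilates w, so the induction hypothesis applies to w in place of z; this is why z is
    -- generalized. The remaining term, with no factor m i, costs e^{-c}‖z‖.
    set w := Real.exp (-c) • (c • m i * y) * z with hw
    have hyl : Commute (l.map m).prod y := by
      refine hyc _ (Commute.smul_right ?_ c)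
      exact Commute.list_prod_left _ _ fun x hx => by
        obtain ⟨j, -, rfl⟩ := List.mem_map.1 hx
        exact hcomm j i
    have hml : Commute (l.map m).prod (m i) :=
      Commute.list_prod_left _ _ fun x hx => by
        obtain ⟨j, -, rfl⟩ := List.mem_map.1 hx
        exact hcomm j i
    have hyi : Commute (m i) y := hyc _ ((Commute.refl _).smul_right c)
    have hw0 : (l.map m).prod * w = 0 := by
      have e : (l.map m).prod * (m i * y * z) = y * (((m i) * (l.map m).prod) * z) := by
        rw [← mul_assoc, ← mul_assoc, hml.eq, mul_assoc _ _ y, hyl.eq,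
          ← mul_assoc, hyi.eq, mul_assoc, mul_assoc, mul_assoc]
      rw [hw, smul_mul_assoc, smul_mul_assoc, smul_mul_assoc, mul_smul_comm, mul_smul_comm, e]
      rw [List.map_cons, List.prod_cons] at hz
      rw [hz]
      simp
    have hwn : ‖w‖ ≤ ‖z‖ := by
      have h1 : Real.exp (-c) • (c • m i * y) =
          Real.exp (-c) • (NormedSpace.exp (c • m i) - 1) := by rw [hy]; simp
      have h2 : ‖Real.exp (-c) • (c • m i * y)‖ ≤ 1 := by
        rw [h1, norm_smul, Real.norm_of_nonneg (Real.exp_pos _).le]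
        have h3 : ‖c • m i‖ ≤ c := by
          rw [norm_smul, Real.norm_of_nonneg hc]
          exact mul_le_of_le_one_right hc (hm i)
        have h4 : ‖NormedSpace.exp (c • m i) - 1‖ ≤ Real.exp c :=
          (norm_exp_sub_one_le_exp_norm _).trans
            (by linarith [Real.exp_le_exp.2 h3])
        calc _ ≤ Real.exp (-c) * Real.exp c := by gcongr
          _ = 1 := by rw [← Real.exp_add]; simp
      calc ‖w‖ ≤ ‖Real.exp (-c) • (c • m i * y)‖ * ‖z‖ := norm_mul_le _ _
        _ ≤ 1 * ‖z‖ := by gcongr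
        _ = ‖z‖ := one_mul _
    have hSn : ‖NormedSpace.exp S‖ ≤ 1 := norm_exp_list_sum_le_one m hcomm hm hc l
    have hsplit : NormedSpace.exp (((i :: l).map fun j => c • (m j - 1)).sum) * z =
        Real.exp (-c) • (NormedSpace.exp S * z) + NormedSpace.exp S * w := by
      rw [List.map_cons, List.sum_cons, add_comm, exp_add_of_commute_real hsum.symm, hE, hw,
        mul_assoc, add_mul, mul_add, smul_mul_assoc, one_mul, mul_smul_comm]
    rw [hsplit]
    calc _ ≤ ‖Real.exp (-c) • (NormedSpace.exp S * z)‖ + ‖NormedSpace.exp S * w‖ := norm_add_le _ _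
      _ ≤ Real.exp (-c) * (1 * ‖z‖) + l.length * Real.exp (-c) * ‖z‖ := by
        refine add_le_add ?_ ?_
        · rw [norm_smul, Real.norm_of_nonneg (Real.exp_pos _).le]
          gcongr
          exact (norm_mul_le _ _).trans (by gcongr)
        · exact (ih w hw0).trans (by gcongr)
      _ = _ := by
        rw [List.length_cons]
        push_cast
        ring

end BanachAlgebra

/-! ### Walk matrices and heat kernels on a finite group -/

section Walk

open Classical Matrix

attribute [local instance] Matrix.linftyOpNormedAddCommGroup Matrix.linftyOpNormedSpace
  Matrix.linftyOpNormedRing Matrix.linftyOpNormedAlgebra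

variable {G : Type*} [Group G]

theorem walkMatrix_apply (μ : G → ℝ) (x y : G) : walkMatrix μ x y = μ (x⁻¹ * y) := rfl

variable [Fintype G]

/-- Class functions are central in the group algebra. The substitution z ↦ y z⁻¹ x exchanges the two
factors of the convolution. -/
theorem walkMatrix_commute {μ ν : G → ℝ} (hν : ∀ g h, ν (g * h) = ν (h * g)) :
    Commute (walkMatrix μ) (walkMatrix ν) := by
  ext x y
  rw [Matrix.mul_apply, Matrix.mul_apply]
  simp only [walkMatrix_apply]
  let e : G ≃ G := (Equiv.inv G).trans ((Equiv.mulRight x).trans (Equiv.mulLeft y))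
  refine Fintype.sum_equiv e _ _ fun z => ?_
  have h1 : (e z)⁻¹ * y = x⁻¹ * z := by simp [e, mul_assoc]
  have h2 : ν (x⁻¹ * e z) = ν (z⁻¹ * y) := by
    rw [hν]
    simp only [e, Equiv.trans_apply, Equiv.inv_apply, Equiv.coe_mulRight, Equiv.coe_mulLeft]
    rw [mul_assoc, mul_assoc, mul_inv_cancel, mul_one, hν]
  rw [h1, h2, mul_comm]

omit [Group G] in
theorem sum_abs_row_le_norm (M : Matrix G G ℝ) (x : G) : ∑ y, |M x y| ≤ ‖M‖ := by
  rw [Matrix.linfty_opNorm_def]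
  have h := Finset.le_sup (f := fun i : G => ∑ j : G, ‖M i j‖₊) (Finset.mem_univ x)
  have h2 := NNReal.coe_le_coe.2 h
  simpa [NNReal.coe_sum] using h2

theorem norm_walkMatrix_le (μ : G → ℝ) : ‖walkMatrix μ‖ ≤ ∑ g, |μ g| := by
  rw [Matrix.linfty_opNorm_def]
  have h : (Finset.univ.sup fun i : G => ∑ j : G, ‖walkMatrix μ i j‖₊) ≤ ∑ g, ‖μ g‖₊ := by
    refine Finset.sup_le fun x _ => le_of_eq ?_
    exact Fintype.sum_equiv (Equiv.mulLeft x⁻¹) _ _ fun y => rfl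
  have h2 := NNReal.coe_le_coe.2 h
  simpa [NNReal.coe_sum] using h2

/-- Nonnegative functions of total mass one. -/
structure IsProbDist (μ : G → ℝ) : Prop where
  nonneg : ∀ g, 0 ≤ μ g
  sum_eq_one : ∑ g, μ g = 1

theorem IsProbDist.norm_walkMatrix_le_one {μ : G → ℝ} (h : IsProbDist μ) :
    ‖walkMatrix μ‖ ≤ 1 := by
  refine (norm_walkMatrix_le μ).trans (le_of_eq ?_)
  simp_rw [abs_of_nonneg (h.nonneg _)]
  exact h.sum_eq_one

theorem hasSum_heatKernel (μ : G → ℝ) (t : ℝ) (x y : G) :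
    HasSum (fun k : ℕ => Real.exp (-t) * t ^ k / (k.factorial : ℝ) * (walkMatrix μ ^ k) x y)
      ((Real.exp (-t) • NormedSpace.exp (t • walkMatrix μ)) x y) := by
  have h := (NormedSpace.hasSum_exp_smul (t • walkMatrix μ)).const_smul (Real.exp (-t))
  have h2 := h.map (Matrix.entryAddMonoidHom ℝ x y) (by
    exact (continuous_apply y).comp (continuous_apply x))
  have e : (fun k : ℕ => Real.exp (-t) * t ^ k / (k.factorial : ℝ) * (walkMatrix μ ^ k) x y) =
      (Matrix.entryAddMonoidHom ℝ x y) ∘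
        fun k : ℕ => Real.exp (-t) • ((k.factorial : ℝ)⁻¹) • (t • walkMatrix μ) ^ k := by
    ext k
    simp [smul_pow]
    ring
  rw [e]
  exact h2

/-- Identifies the defining series with an operator exponential, so that the Banach algebra
estimates apply to the walk in the ℓ^∞ operator norm. -/
theorem heatKernel_eq_exp (μ : G → ℝ) (t : ℝ) (x y : G) :
    heatKernel μ t x y = NormedSpace.exp (t • (walkMatrix μ - 1)) x y := by
  refine (hasSum_heatKernel μ t x y).tsum_eq.trans ?_
  exact (congrFun (congrFun (exp_smul_sub_one (A := Matrix G G ℝ) t (walkMatrix μ)) x) y).symm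

theorem hasSum_heatKernel' (μ : G → ℝ) (t : ℝ) (x y : G) :
    HasSum (fun k : ℕ => Real.exp (-t) * t ^ k / (k.factorial : ℝ) * (walkMatrix μ ^ k) x y)
      (heatKernel μ t x y) :=
  (hasSum_heatKernel μ t x y).summable.hasSum

theorem sum_heatKernel_mul_of_eigenvector {μ : G → ℝ} {φ : G → ℝ} {m : ℝ}
    (h : walkMatrix μ *ᵥ φ = m • φ) (t : ℝ) (x : G) :
    ∑ y, heatKernel μ t x y * φ y = Real.exp (-(t * (1 - m))) * φ x := by
  have hk : ∀ k : ℕ, (walkMatrix μ ^ k) *ᵥ φ = m ^ k • φ := by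
    intro k
    induction k with
    | zero => simp
    | succ k ih => rw [pow_succ, ← Matrix.mulVec_mulVec, h, Matrix.mulVec_smul, ih, smul_smul,
        pow_succ, mul_comm]
  have h1 : HasSum (fun k : ℕ => ∑ y, Real.exp (-t) * t ^ k / (k.factorial : ℝ) *
      (walkMatrix μ ^ k) x y * φ y) (∑ y, heatKernel μ t x y * φ y) :=
    hasSum_sum fun y _ => (hasSum_heatKernel' μ t x y).mul_right (φ y)
  have h2 : HasSum (fun k : ℕ => ∑ y, Real.exp (-t) * t ^ k / (k.factorial : ℝ) *
      (walkMatrix μ ^ k) x y * φ y) (Real.exp (-(t * (1 - m))) * φ x) := by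
    have hr : HasSum (fun k : ℕ => (t * m) ^ k / (k.factorial : ℝ)) (Real.exp (t * m)) := by
      rw [Real.exp_eq_exp_ℝ]
      exact NormedSpace.expSeries_div_hasSum_exp (t * m)
    have h3 := (hr.mul_left (Real.exp (-t))).mul_right (φ x)
    have e : Real.exp (-(t * (1 - m))) = Real.exp (-t) * Real.exp (t * m) := by
      rw [← Real.exp_add]
      ring_nf
    rw [e]
    have e2 : (fun k : ℕ => ∑ y, Real.exp (-t) * t ^ k / (k.factorial : ℝ) *
        (walkMatrix μ ^ k) x y * φ y) =
        fun k : ℕ => Real.exp (-t) * ((t * m) ^ k / (k.factorial : ℝ)) * φ x := by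
      funext k
      have h4 := congrFun (hk k) x
      simp only [Matrix.mulVec, dotProduct, Pi.smul_apply, smul_eq_mul] at h4
      simp_rw [mul_assoc]
      rw [← Finset.mul_sum, h4, mul_pow]
      ring
    rw [e2]
    exact h3
  exact h1.unique h2

theorem walkMatrix_mulVec_one {μ : G → ℝ} (h : IsProbDist μ) :
    walkMatrix μ *ᵥ (fun _ => (1 : ℝ)) = (1 : ℝ) • fun _ => (1 : ℝ) := by
  ext x
  simp only [Matrix.mulVec, dotProduct, walkMatrix_apply, mul_one, Pi.smul_apply, smul_eq_mul]
  rw [← h.sum_eq_one]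
  exact Fintype.sum_equiv (Equiv.mulLeft x⁻¹) _ _ fun y => rfl

theorem sum_heatKernel {μ : G → ℝ} (h : IsProbDist μ) (t : ℝ) (x : G) :
    ∑ y, heatKernel μ t x y = 1 := by
  simpa using sum_heatKernel_mul_of_eigenvector (walkMatrix_mulVec_one h) t x

theorem heatKernel_nonneg {μ : G → ℝ} (h : IsProbDist μ) {t : ℝ} (ht : 0 ≤ t) (x y : G) :
    0 ≤ heatKernel μ t x y := by
  have hk : ∀ (k : ℕ) (x y : G), 0 ≤ (walkMatrix μ ^ k) x y := by
    intro k
    induction k with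
    | zero =>
      intro x y
      rw [pow_zero, Matrix.one_apply]
      split_ifs <;> norm_num
    | succ k ih =>
      intro x y
      rw [pow_succ, Matrix.mul_apply]
      exact Finset.sum_nonneg fun z _ => mul_nonneg (ih x z) (h.nonneg _)
  refine (hasSum_heatKernel' μ t x y).nonneg fun k => mul_nonneg (by positivity) (hk k x y)

theorem heatKernel_translate (μ : G → ℝ) (t : ℝ) (x y : G) :
    heatKernel μ t x y = heatKernel μ t 1 (x⁻¹ * y) := by
  have hk : ∀ (k : ℕ) (x y : G), (walkMatrix μ ^ k) x y = (walkMatrix μ ^ k) 1 (x⁻¹ * y) := by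
    intro k
    induction k with
    | zero =>
      intro x y
      rw [pow_zero, Matrix.one_apply, Matrix.one_apply]
      congr 1
      rw [eq_iff_iff, eq_comm (a := (1 : G)), inv_mul_eq_one]
    | succ k ih =>
      intro x y
      rw [pow_succ, Matrix.mul_apply, Matrix.mul_apply]
      refine Fintype.sum_equiv (Equiv.mulLeft x⁻¹) _ _ fun z => ?_
      rw [ih x z]
      simp [walkMatrix_apply, mul_assoc]
  unfold heatKernel
  exact tsum_congr fun k => by rw [hk]

/-- The walk is left invariant, so every starting point gives the same distance and the supremum is
over a constant. -/
theorem tvDist_eq (μ : G → ℝ) (t : ℝ) :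
    tvDist μ t = (1 / 2 : ℝ) * ∑ y : G, |heatKernel μ t 1 y - 1 / (Fintype.card G : ℝ)| := by
  unfold tvDist
  have : ∀ x : G, (1 / 2 : ℝ) * ∑ y : G, |heatKernel μ t x y - 1 / (Fintype.card G : ℝ)| =
      (1 / 2 : ℝ) * ∑ y : G, |heatKernel μ t 1 y - 1 / (Fintype.card G : ℝ)| := by
    intro x
    congr 1
    refine Fintype.sum_equiv (Equiv.mulLeft x⁻¹) _ _ fun y => ?_
    rw [heatKernel_translate]
    rfl
  simp_rw [this]
  exact ciSup_const

theorem tvDist_le_one {μ : G → ℝ} (h : IsProbDist μ) {t : ℝ} (ht : 0 ≤ t) : tvDist μ t ≤ 1 := by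
  rw [tvDist_eq]
  have h1 : ∑ y : G, |heatKernel μ t 1 y - 1 / (Fintype.card G : ℝ)| ≤
      ∑ y : G, (heatKernel μ t 1 y + 1 / (Fintype.card G : ℝ)) := by
    refine Finset.sum_le_sum fun y _ => ?_
    have h2 := heatKernel_nonneg h ht 1 y
    have h3 : (0 : ℝ) ≤ 1 / (Fintype.card G : ℝ) := by positivity
    rw [abs_le]
    constructor <;> linarith
  rw [Finset.sum_add_distrib, sum_heatKernel h] at h1
  have h2 : ∑ _y : G, 1 / (Fintype.card G : ℝ) = 1 := by simp
  rw [h2] at h1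
  linarith

theorem tvDist_nonneg (μ : G → ℝ) (t : ℝ) : 0 ≤ tvDist μ t := by
  rw [tvDist_eq]
  positivity

/-- The total variation distance dominates differences of probabilities of events. -/
theorem one_sub_sub_le_tvDist {μ : G → ℝ} (h : IsProbDist μ) (t : ℝ) (S : Finset G) :
    1 - ∑ y ∈ Sᶜ, heatKernel μ t 1 y - (S.card : ℝ) / Fintype.card G ≤ tvDist μ t := by
  rw [tvDist_eq]
  set u : ℝ := 1 / (Fintype.card G : ℝ) with hu
  set f : G → ℝ := heatKernel μ t 1 with hf
  have h1 : ∑ y, f y = 1 := sum_heatKernel h t 1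
  have h2 : ∑ _y : G, u = 1 := by simp [hu]
  have h3 := Finset.sum_add_sum_compl S f
  have h4 := Finset.sum_add_sum_compl S fun y => |f y - u|
  have h5 : ∑ y ∈ S, (f y - u) ≤ ∑ y ∈ S, |f y - u| :=
    Finset.sum_le_sum fun y _ => le_abs_self _
  have h6 : ∑ y ∈ Sᶜ, (u - f y) ≤ ∑ y ∈ Sᶜ, |f y - u| :=
    Finset.sum_le_sum fun y _ => by rw [abs_sub_comm]; exact le_abs_self _
  have h7 := Finset.sum_add_sum_compl S fun _ => u
  rw [Finset.sum_sub_distrib] at h5 h6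
  have h8 : ∑ _y ∈ S, u = (S.card : ℝ) / Fintype.card G := by
    rw [Finset.sum_const, nsmul_eq_mul, hu]; ring
  rw [← h8]
  linarith

/-! ### Averaging over a subgroup -/

omit [Group G] in
theorem unifOn_isProbDist {C : Set G} (hC : C.Nonempty) :
    IsProbDist (unifOn C) := by
  refine ⟨fun g => ?_, ?_⟩
  · unfold unifOn
    split_ifs <;> positivity
  · unfold unifOn
    rw [← Finset.sum_filter, Finset.sum_const, nsmul_eq_mul]
    have : (Finset.univ.filter fun g => g ∈ C).card = C.ncard := by
      rw [Set.ncard_eq_toFinset_card', Set.toFinset_card, Fintype.card_subtype]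
    rw [this, mul_one_div_cancel]
    have : 0 < C.ncard := (Set.ncard_pos (Set.toFinite _)).2 hC
    positivity

theorem unifOn_subgroup_isProbDist (N : Subgroup G) : IsProbDist (unifOn (N : Set G)) :=
  unifOn_isProbDist ⟨1, N.one_mem⟩

/-- Averaging over a subgroup is a symmetric idempotent. This turns the ℓ² norm of an averaged law
into a quadratic form with a single kernel. -/
theorem sum_unifOn_mul_unifOn (N : Subgroup G) (z z' : G) :
    ∑ y, unifOn (N : Set G) (z⁻¹ * y) * unifOn (N : Set G) (z'⁻¹ * y) =
      unifOn (N : Set G) (z⁻¹ * z') := by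
  have h : ∀ y, unifOn (N : Set G) (z⁻¹ * y) * unifOn (N : Set G) (z'⁻¹ * y) =
      unifOn (N : Set G) (z⁻¹ * z') * unifOn (N : Set G) (z'⁻¹ * y) := by
    intro y
    by_cases hy : z'⁻¹ * y ∈ N
    · congr 1
      unfold unifOn
      have e : z⁻¹ * y = z⁻¹ * z' * (z'⁻¹ * y) := by group
      simp only [SetLike.mem_coe]
      rw [e, N.mul_mem_cancel_right hy]
    · have : unifOn (N : Set G) (z'⁻¹ * y) = 0 := by simp [unifOn, hy]
      rw [this, mul_zero, mul_zero]
  simp_rw [h]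
  rw [← Finset.mul_sum]
  rw [show ∑ y, unifOn (N : Set G) (z'⁻¹ * y) = ∑ y, unifOn (N : Set G) y from
    Fintype.sum_equiv (Equiv.mulLeft z'⁻¹) _ _ fun y => rfl]
  rw [(unifOn_subgroup_isProbDist N).sum_eq_one, mul_one]

/-- Total variation distance is at most the loss from averaging over `N` plus an `ℓ²` distance for
the averaged walk. -/
theorem tvDist_le_norm_add_sqrt {μ : G → ℝ} (h : IsProbDist μ) (N : Subgroup G) (t : ℝ) :
    tvDist μ t ≤ (1 / 2) * ‖NormedSpace.exp (t • (walkMatrix μ - 1)) *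
        (1 - walkMatrix (unifOn (N : Set G)))‖ +
      (1 / 2) * Real.sqrt ((Fintype.card G : ℝ) * (∑ z, ∑ z', heatKernel μ t 1 z *
        heatKernel μ t 1 z' * unifOn (N : Set G) (z⁻¹ * z')) - 1) := by
  rw [tvDist_eq, ← mul_add]
  refine mul_le_mul_of_nonneg_left ?_ (by norm_num)
  set f : G → ℝ := heatKernel μ t 1 with hf
  set u := unifOn (N : Set G) with hu
  -- The law at time t after averaging over N.
  set q : G → ℝ := fun y => ∑ z, f z * u (z⁻¹ * y) with hq
  set c : ℝ := 1 / (Fintype.card G : ℝ) with hc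
  have hcard : (Fintype.card G : ℝ) ≠ 0 := by positivity
  have hE : ∀ y, (NormedSpace.exp (t • (walkMatrix μ - 1)) * (1 - walkMatrix u)) 1 y =
      f y - q y := by
    intro y
    rw [mul_sub, mul_one, Matrix.sub_apply, ← heatKernel_eq_exp, Matrix.mul_apply]
    simp only [← heatKernel_eq_exp]
    rfl
  have h1 : ∑ y, |f y - q y| ≤ ‖NormedSpace.exp (t • (walkMatrix μ - 1)) * (1 - walkMatrix u)‖ := by
    have := sum_abs_row_le_norm (NormedSpace.exp (t • (walkMatrix μ - 1)) * (1 - walkMatrix u)) 1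
    simpa only [hE] using this
  have hqs : ∑ y, q y = 1 := by
    rw [hq, Finset.sum_comm]
    have : ∀ z, ∑ y, f z * u (z⁻¹ * y) = f z := fun z => by
      rw [← Finset.mul_sum, show ∑ y, u (z⁻¹ * y) = ∑ y, u y from
        Fintype.sum_equiv (Equiv.mulLeft z⁻¹) _ _ fun y => rfl,
        (unifOn_subgroup_isProbDist N).sum_eq_one, mul_one]
    simp_rw [this]
    exact sum_heatKernel h t 1
  have hq2 : ∑ y, q y ^ 2 = ∑ z, ∑ z', f z * f z' * u (z⁻¹ * z') := by
    have e : ∀ y, q y ^ 2 = ∑ z, ∑ z', f z * f z' * (u (z⁻¹ * y) * u (z'⁻¹ * y)) := by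
      intro y
      rw [sq, hq, Finset.sum_mul_sum]
      refine Finset.sum_congr rfl fun z _ => Finset.sum_congr rfl fun z' _ => by ring
    simp_rw [e]
    rw [Finset.sum_comm]
    refine Finset.sum_congr rfl fun z _ => ?_
    rw [Finset.sum_comm]
    refine Finset.sum_congr rfl fun z' _ => ?_
    rw [← Finset.mul_sum, sum_unifOn_mul_unifOn]
  -- Cauchy–Schwarz; since q has total mass one, expanding the square leaves |G| ∑ q² - 1.
  have h2 : ∑ y, |q y - c| ≤ Real.sqrt ((Fintype.card G : ℝ) *
      (∑ z, ∑ z', f z * f z' * u (z⁻¹ * z')) - 1) := by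
    refine Real.le_sqrt_of_sq_le ?_
    have hcs := sq_sum_le_card_mul_sum_sq (s := (Finset.univ : Finset G)) (f := fun y => |q y - c|)
    refine hcs.trans (le_of_eq ?_)
    rw [← hq2, Finset.card_univ]
    have e : ∀ y, |q y - c| ^ 2 = q y ^ 2 - 2 * c * q y + c ^ 2 := fun y => by
      rw [sq_abs]; ring
    simp_rw [e]
    rw [Finset.sum_add_distrib, Finset.sum_sub_distrib, ← Finset.mul_sum, hqs, Finset.sum_const,
      Finset.card_univ, nsmul_eq_mul, hc]
    field_simp
    ring
  calc ∑ y, |f y - c| ≤ ∑ y, (|f y - q y| + |q y - c|) :=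
        Finset.sum_le_sum fun y _ => abs_sub_le _ _ _
    _ = ∑ y, |f y - q y| + ∑ y, |q y - c| := Finset.sum_add_distrib
    _ ≤ _ := add_le_add h1 h2

end Walk

/-! ### Superdiagonals and superdiagonal classes in the unit upper-triangular group -/

section UnitUpper

open Classical Matrix

attribute [local instance] Matrix.linftyOpNormedAddCommGroup Matrix.linftyOpNormedSpace
  Matrix.linftyOpNormedRing Matrix.linftyOpNormedAlgebra

variable {n p : ℕ}

/-- Equality of group elements is decided classically, as in `heatKernel`. -/
noncomputable instance unitUpperDecidableEq : DecidableEq (unitUpper n p) :=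
  fun a b => Classical.propDecidable (a = b)

/-- The underlying matrix of a unit upper-triangular group element. -/
abbrev unitUpper.toMat (g : unitUpper n p) : Matrix (Fin n) (Fin n) (ZMod p) := g.1

open unitUpper

theorem unitUpper.isUnitUpper (g : unitUpper n p) : IsUnitUpper (toMat g) := g.2

theorem unitUpper.toMat_injective : Function.Injective (toMat (n := n) (p := p)) :=
  fun _ _ h => Subtype.ext (Subtype.ext h)

theorem unitUpper.toMat_mul (g h : unitUpper n p) : toMat (g * h) = toMat g * toMat h := by
  simp [toMat]

theorem unitUpper.toMat_one : toMat (1 : unitUpper n p) = 1 := by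
  simp [toMat]

theorem unitUpper.toMat_mul_toMat_inv (g : unitUpper n p) : toMat g * toMat g⁻¹ = 1 := by
  rw [← toMat_mul, mul_inv_cancel, toMat_one]

theorem unitUpper.toMat_inv_mul_toMat (g : unitUpper n p) : toMat g⁻¹ * toMat g = 1 := by
  rw [← toMat_mul, inv_mul_cancel, toMat_one]

/-- The group element with a given unit upper-triangular matrix. -/
def unitUpper.ofMat (A : Matrix (Fin n) (Fin n) (ZMod p)) (hA : IsUnitUpper A) : unitUpper n p :=
  ⟨⟨A, hA.det_eq_one⟩, hA⟩

@[simp]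
theorem unitUpper.toMat_ofMat (A : Matrix (Fin n) (Fin n) (ZMod p)) (hA : IsUnitUpper A) :
    toMat (ofMat A hA) = A := rfl

/-- The row of the `i`-th superdiagonal position. -/
def superRow (i : Fin (n - 1)) : Fin n := ⟨i.1, by omega⟩

/-- The column of the `i`-th superdiagonal position. -/
def superCol (i : Fin (n - 1)) : Fin n := ⟨i.1 + 1, by omega⟩

@[simp] theorem superRow_val (i : Fin (n - 1)) : (superRow i).val = i.val := rfl
@[simp] theorem superCol_val (i : Fin (n - 1)) : (superCol i).val = i.val + 1 := rfl

theorem superRow_injective : Function.Injective (superRow (n := n)) := fun i j h => by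
  have := congrArg Fin.val h
  exact Fin.ext this

/-- The superdiagonal. -/
def superdiag (g : unitUpper n p) (i : Fin (n - 1)) : ZMod p := toMat g (superRow i) (superCol i)

/-- Triangularity kills every term of the sum except the indices i and i + 1. Nothing is assumed on
the diagonals, because the identity is also applied to strictly upper-triangular factors. -/
theorem mul_apply_superRow_superCol {R : Type*} [CommRing R] {A B : Matrix (Fin n) (Fin n) R}
    (hA : ∀ i j : Fin n, j < i → A i j = 0) (hB : ∀ i j : Fin n, j < i → B i j = 0)
    (i : Fin (n - 1)) :
    (A * B) (superRow i) (superCol i) = A (superRow i) (superRow i) * B (superRow i) (superCol i) +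
      A (superRow i) (superCol i) * B (superCol i) (superCol i) := by
  rw [Matrix.mul_apply]
  have hne : superRow i ≠ superCol i := fun h => by
    have := congrArg Fin.val h
    simp at this
  rw [← Finset.sum_subset (Finset.subset_univ {superRow i, superCol i})]
  · rw [Finset.sum_pair hne]
  · intro k _ hk
    simp only [Finset.mem_insert, Finset.mem_singleton, not_or, Fin.ext_iff, superRow_val,
      superCol_val] at hk
    rcases lt_or_ge k (superRow i) with h | h
    · rw [hA _ _ h, zero_mul]
    · have : superCol i < k := by
        rw [Fin.lt_def, superCol_val]
        rw [Fin.le_def, superRow_val] at h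
        omega
      rw [hB _ _ this, mul_zero]

theorem superdiag_mul (g h : unitUpper n p) : superdiag (g * h) = superdiag g + superdiag h := by
  ext i
  simp only [superdiag, Pi.add_apply]
  rw [toMat_mul, mul_apply_superRow_superCol (isUnitUpper g).1 (isUnitUpper h).1, (isUnitUpper g).2,
    (isUnitUpper h).2]
  ring

theorem superdiag_one : superdiag (1 : unitUpper n p) = 0 := by
  have h := superdiag_mul (1 : unitUpper n p) 1
  rw [mul_one] at h
  simpa using h

theorem superdiag_inv (g : unitUpper n p) : superdiag g⁻¹ = -superdiag g := by
  have h := superdiag_mul g⁻¹ g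
  rw [inv_mul_cancel, superdiag_one] at h
  exact eq_neg_of_add_eq_zero_left h.symm

variable (n p) in
/-- The superdiagonal as a homomorphism. -/
def superdiagHom : unitUpper n p →* Multiplicative (Fin (n - 1) → ZMod p) where
  toFun g := Multiplicative.ofAdd (superdiag g)
  map_one' := by rw [superdiag_one]; rfl
  map_mul' g h := by rw [superdiag_mul]; rfl

theorem superdiagMatrix_isUnitUpper (i : Fin (n - 1)) (c : ZMod p) :
    IsUnitUpper (superdiagMatrix n p i c) := by
  refine ⟨fun k l hkl => ?_, fun k => ?_⟩
  · rw [superdiagMatrix, Matrix.add_apply, Matrix.one_apply_ne hkl.ne', Matrix.single_apply,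
      if_neg, add_zero]
    rintro ⟨rfl, rfl⟩
    simp [Fin.lt_def] at hkl
  · rw [superdiagMatrix, Matrix.add_apply, Matrix.one_apply_eq, Matrix.single_apply, if_neg,
      add_zero]
    rintro ⟨h1, h2⟩
    have := congrArg Fin.val (h1.trans h2.symm)
    simp at this

/-- `I + c E_{i,i+1}` as a group element. -/
def superdiagElt (n p : ℕ) (i : Fin (n - 1)) (c : ZMod p) : unitUpper n p :=
  ofMat (superdiagMatrix n p i c) (superdiagMatrix_isUnitUpper i c)

theorem mem_superdiagClass_iff (i : Fin (n - 1)) (c : ZMod p) (y : unitUpper n p) :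
    y ∈ superdiagClass n p i c ↔ ∃ x, y = x * superdiagElt n p i c * x⁻¹ := by
  unfold superdiagClass
  refine exists_congr fun x => ?_
  rw [← toMat_injective.eq_iff, toMat_mul, toMat_mul]
  rfl

theorem superdiag_superdiagElt (i : Fin (n - 1)) (c : ZMod p) :
    superdiag (superdiagElt n p i c) = Pi.single i c := by
  ext j
  change superdiagMatrix n p i c (superRow j) (superCol j) = _
  rw [superdiagMatrix, Matrix.add_apply, Matrix.one_apply_ne, zero_add, Matrix.single_apply]
  · by_cases h : j = i
    · subst h
      rw [if_pos ⟨rfl, rfl⟩, Pi.single_eq_same]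
    · rw [if_neg, Pi.single_eq_of_ne h]
      rintro ⟨h1, -⟩
      exact h (Fin.ext (congrArg Fin.val h1).symm)
  · intro h
    have := congrArg Fin.val h
    simp at this

theorem superdiag_of_mem_superdiagClass {i : Fin (n - 1)} {c : ZMod p} {y : unitUpper n p}
    (hy : y ∈ superdiagClass n p i c) : superdiag y = Pi.single i c := by
  obtain ⟨x, rfl⟩ := (mem_superdiagClass_iff i c y).1 hy
  rw [superdiag_mul, superdiag_mul, superdiag_inv, superdiag_superdiagElt]
  abel

theorem conj_mem_superdiagClass {i : Fin (n - 1)} {c : ZMod p} (x y : unitUpper n p) :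
    x * y * x⁻¹ ∈ superdiagClass n p i c ↔ y ∈ superdiagClass n p i c := by
  simp only [mem_superdiagClass_iff]
  constructor
  · rintro ⟨z, hz⟩
    refine ⟨x⁻¹ * z, ?_⟩
    rw [mul_inv_eq_iff_eq_mul, ← eq_inv_mul_iff_mul_eq] at hz
    rw [hz]
    group
  · rintro ⟨z, rfl⟩
    exact ⟨x * z, by group⟩

theorem unifOn_superdiagClass_comm (i : Fin (n - 1)) (c : ZMod p) (g h : unitUpper n p) :
    unifOn (superdiagClass n p i c) (g * h) = unifOn (superdiagClass n p i c) (h * g) := by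
  unfold unifOn
  rw [← conj_mem_superdiagClass (i := i) (c := c) h (g * h)]
  have : h * (g * h) * h⁻¹ = h * g := by group
  rw [this]

theorem superdiagClass_nonempty (i : Fin (n - 1)) (c : ZMod p) :
    (superdiagClass n p i c).Nonempty :=
  ⟨superdiagElt n p i c, (mem_superdiagClass_iff _ _ _).2 ⟨1, by simp⟩⟩

/-! ### Rank-one parametrization of the superdiagonal classes -/

/-- The column vector `(u_1, …, u_{i-1}, 1, 0, …, 0)`. -/
def colPart (i : Fin n) (u : Fin n → ZMod p) (k : Fin n) : ZMod p :=
  if k < i then u k else if k = i then 1 else 0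

/-- The row vector `(0, …, 0, c, v_{i+2}, …, v_n)` with `c` in position `i + 1`. -/
def rowPart (i : Fin n) (c : ZMod p) (v : Fin n → ZMod p) (k : Fin n) : ZMod p :=
  if i.val + 1 < k.val then v k else if k.val = i.val + 1 then c else 0

theorem colPart_of_lt {i k : Fin n} (u : Fin n → ZMod p) (h : i < k) : colPart i u k = 0 := by
  rw [colPart, if_neg h.not_gt, if_neg h.ne']

theorem rowPart_of_le {i k : Fin n} (c : ZMod p) (v : Fin n → ZMod p) (h : k ≤ i) :
    rowPart i c v k = 0 := by
  rw [Fin.le_def] at h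
  rw [rowPart, if_neg (by omega), if_neg (by omega)]

theorem colPart_self (i : Fin n) (u : Fin n → ZMod p) : colPart i u i = 1 := by
  simp [colPart]

theorem rowPart_superCol (i : Fin (n - 1)) (c : ZMod p) (v : Fin n → ZMod p) :
    rowPart (superRow i) c v (superCol i) = c := by
  simp [rowPart]

/-- The supports are disjoint: the row vector lives beyond i and the column vector up to j ≤ i.
Hence jumps multiplied in decreasing order of position produce no cross terms. -/
theorem rowPart_dotProduct_colPart {i j : Fin n} (h : j ≤ i) (c : ZMod p) (u v : Fin n → ZMod p) :
    rowPart i c v ⬝ᵥ colPart j u = 0 := by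
  refine Finset.sum_eq_zero fun k _ => ?_
  rcases le_or_gt k i with hk | hk
  · rw [rowPart_of_le c v hk, zero_mul]
  · rw [colPart_of_lt u (h.trans_lt hk), mul_zero]

theorem isUnitUpper_one_add_vecMulVec (i : Fin n) (c : ZMod p) (u v : Fin n → ZMod p) :
    IsUnitUpper (1 + vecMulVec (colPart i u) (rowPart i c v)) := by
  have h0 : ∀ k l : Fin n, l ≤ k → vecMulVec (colPart i u) (rowPart i c v) k l = 0 := by
    intro k l hkl
    rw [vecMulVec_apply]
    rcases le_or_gt k i with hk | hk
    · rw [rowPart_of_le c v (hkl.trans hk), mul_zero]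
    · rw [colPart_of_lt u hk, zero_mul]
  refine ⟨fun k l hkl => ?_, fun k => ?_⟩
  · rw [Matrix.add_apply, h0 k l hkl.le, Matrix.one_apply_ne hkl.ne', add_zero]
  · rw [Matrix.add_apply, h0 k k le_rfl, Matrix.one_apply_eq, add_zero]

/-- The element `I + u vᵀ` with `u = colPart i u` and `v = rowPart i c v`. -/
def rankOneElt (i : Fin n) (c : ZMod p) (u v : Fin n → ZMod p) : unitUpper n p :=
  ofMat _ (isUnitUpper_one_add_vecMulVec i c u v)

theorem toMat_rankOneElt (i : Fin n) (c : ZMod p) (u v : Fin n → ZMod p) :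
    toMat (rankOneElt i c u v) = 1 + vecMulVec (colPart i u) (rowPart i c v) := rfl

/-- Conjugating the elementary matrix leaves a rank-one perturbation of the identity: column i of x
times c times row i + 1 of x⁻¹. -/
theorem toMat_conj_superdiagElt (i : Fin (n - 1)) (c : ZMod p) (x : unitUpper n p) :
    toMat (x * superdiagElt n p i c * x⁻¹) =
      1 + vecMulVec (fun k => toMat x k (superRow i)) (fun k => c * toMat x⁻¹ (superCol i) k) := by
  rw [toMat_mul, toMat_mul]
  have h : toMat (superdiagElt n p i c) = 1 + Matrix.single (superRow i) (superCol i) c := rfl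
  rw [h, mul_add, mul_one, add_mul, toMat_mul_toMat_inv]
  congr 1
  ext k l
  rw [Matrix.mul_assoc, vecMulVec_apply, Matrix.mul_apply, Finset.sum_eq_single (superRow i)]
  · congr 1
    rw [Matrix.mul_apply, Finset.sum_eq_single (superCol i)]
    · simp
    · intro j _ hj
      rw [Matrix.single_apply, if_neg (fun h => hj h.2.symm), zero_mul]
    · simp
  · intro j _ hj
    rw [Matrix.mul_apply, Finset.sum_eq_zero, mul_zero]
    intro m _
    rw [Matrix.single_apply, if_neg (fun h => hj h.1.symm), zero_mul]
  · simp

theorem conj_superdiagElt_eq_rankOneElt (i : Fin (n - 1)) (c : ZMod p) (x : unitUpper n p) :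
    x * superdiagElt n p i c * x⁻¹ = rankOneElt (superRow i) c (fun k => toMat x k (superRow i))
      (fun k => c * toMat x⁻¹ (superCol i) k) := by
  apply toMat_injective
  rw [toMat_conj_superdiagElt, toMat_rankOneElt]
  congr 2
  · ext k
    unfold colPart
    split_ifs with h1 h2
    · rfl
    · rw [h2]; exact (isUnitUpper x).2 _
    · exact (isUnitUpper x).1 _ _ (lt_of_le_of_ne (not_lt.1 h1) (Ne.symm h2))
  · ext k
    unfold rowPart
    rw [superRow_val]
    split_ifs with h1 h2
    · rfl
    · have : k = superCol i := Fin.ext h2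
      rw [this, (isUnitUpper (x⁻¹)).2, mul_one]
    · rw [(isUnitUpper (x⁻¹)).1, mul_zero]
      rw [Fin.lt_def, superCol_val]
      omega

/-- Two explicit conjugations suffice: `x1` clears the column entries above position i, and `y` then
clears the row entries beyond i + 1. The second step divides these entries by c, which is where
invertibility of c enters. -/
theorem rankOneElt_mem_superdiagClass (i : Fin (n - 1)) {c : ZMod p} (hc : IsUnit c)
    (u v : Fin n → ZMod p) : rankOneElt (superRow i) c u v ∈ superdiagClass n p i c := by
  obtain ⟨d, hd⟩ := hc.exists_left_inv
  set u' : Fin n → ZMod p := fun k => if k < superRow i then u k else 0 with hu'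
  set v' : Fin n → ZMod p := fun k => if superCol i < k then d * v k else 0 with hv'
  have hx1 : IsUnitUpper (1 + vecMulVec u' (Pi.single (superRow i) 1)) := by
    have h0 : ∀ k l : Fin n, l ≤ k →
        vecMulVec u' (Pi.single (superRow i) (1 : ZMod p)) k l = 0 := by
      intro k l hkl
      rw [vecMulVec_apply]
      by_cases hl : l = superRow i
      · simp only [hu']
        rw [if_neg (by rw [← hl]; exact hkl.not_gt), zero_mul]
      · rw [Pi.single_eq_of_ne hl, mul_zero]
    refine ⟨fun k l hkl => ?_, fun k => ?_⟩
    · rw [Matrix.add_apply, h0 k l hkl.le, Matrix.one_apply_ne hkl.ne', add_zero]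
    · rw [Matrix.add_apply, h0 k k le_rfl, Matrix.one_apply_eq, add_zero]
  have hx2 : IsUnitUpper (1 + vecMulVec (Pi.single (superCol i) 1) v') := by
    have h0 : ∀ k l : Fin n, l ≤ k →
        vecMulVec (Pi.single (superCol i) (1 : ZMod p)) v' k l = 0 := by
      intro k l hkl
      rw [vecMulVec_apply]
      by_cases hk : k = superCol i
      · simp only [hv']
        rw [if_neg (by rw [← hk]; exact hkl.not_gt), mul_zero]
      · rw [Pi.single_eq_of_ne hk, zero_mul]
    refine ⟨fun k l hkl => ?_, fun k => ?_⟩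
    · rw [Matrix.add_apply, h0 k l hkl.le, Matrix.one_apply_ne hkl.ne', add_zero]
    · rw [Matrix.add_apply, h0 k k le_rfl, Matrix.one_apply_eq, add_zero]
  have hlt : superRow i < superCol i := by rw [Fin.lt_def]; simp
  set x1 := ofMat _ hx1 with hx1d
  set y := ofMat _ hx2 with hyd
  refine (mem_superdiagClass_iff i c _).2 ⟨x1 * y⁻¹, ?_⟩
  have key1 : rankOneElt (superRow i) c u v * x1 = x1 * rankOneElt (superRow i) c 0 v := by
    apply toMat_injective
    rw [toMat_mul, toMat_mul, toMat_rankOneElt, toMat_rankOneElt, hx1d, toMat_ofMat]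
    have e1 : rowPart (superRow i) c v ⬝ᵥ u' = 0 := by
      refine Finset.sum_eq_zero fun k _ => ?_
      rcases le_or_gt k (superRow i) with hk | hk
      · rw [rowPart_of_le c v hk, zero_mul]
      · simp only [hu']
        rw [if_neg hk.not_gt, mul_zero]
    have e2 : colPart (superRow i) (0 : Fin n → ZMod p) = Pi.single (superRow i) 1 := by
      ext k
      unfold colPart
      by_cases hk : k = superRow i
      · simp [hk]
      · simp [hk]
    have e3 : colPart (superRow i) u = u' + Pi.single (superRow i) 1 := by
      ext k
      simp only [colPart, hu', Pi.add_apply]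
      by_cases hk : k = superRow i
      · simp [hk]
      · simp [hk]
    rw [mul_add, mul_add, mul_one, mul_one, add_mul, add_mul, one_mul, one_mul,
      vecMulVec_mul_vecMulVec, vecMulVec_mul_vecMulVec, e1, e2, e3, add_vecMulVec]
    simp
    abel
  have key2 : superdiagElt n p i c * y = y * rankOneElt (superRow i) c 0 v := by
    apply toMat_injective
    have h : toMat (superdiagElt n p i c) = 1 + Matrix.single (superRow i) (superCol i) c := rfl
    have hs : Matrix.single (superRow i) (superCol i) c =
        vecMulVec (Pi.single (superRow i) 1) (Pi.single (superCol i) c) := by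
      ext k l
      rw [vecMulVec_apply, Matrix.single_apply]
      by_cases hk : superRow i = k
      · subst hk
        by_cases hl : superCol i = l
        · subst hl; simp
        · simp [hl]
      · simp [hk]
    rw [toMat_mul, toMat_mul, h, hs, toMat_rankOneElt, hyd, toMat_ofMat]
    have e1 : v' ⬝ᵥ Pi.single (superRow i) 1 = 0 := by
      rw [dotProduct_single, hv']
      simp [hlt.not_gt]
    have e2 : colPart (superRow i) (0 : Fin n → ZMod p) = Pi.single (superRow i) 1 := by
      ext k
      unfold colPart
      by_cases hk : k = superRow i
      · simp [hk]
      · simp [hk]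
    have e3 : rowPart (superRow i) c v = Pi.single (superCol i) c + c • v' := by
      ext k
      simp only [rowPart, hv', Pi.add_apply, Pi.smul_apply, smul_eq_mul]
      by_cases hk : k = superCol i
      · simp [hk]
      · have hk' : ¬ k.val = (superRow i).val + 1 := fun h => hk (Fin.ext h)
        rw [Pi.single_eq_of_ne hk, if_neg hk', zero_add, mul_ite, mul_zero, ← mul_assoc,
          mul_comm c d, hd, one_mul]
        rfl
    rw [mul_add, mul_add, mul_one, mul_one, add_mul, add_mul, one_mul, one_mul,
      vecMulVec_mul_vecMulVec, vecMulVec_mul_vecMulVec, e2, e1, e3, vecMulVec_add]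
    simp
    abel
  calc rankOneElt (superRow i) c u v
      = x1 * (y⁻¹ * (y * rankOneElt (superRow i) c 0 v)) * x1⁻¹ := by
        rw [inv_mul_cancel_left, ← key1, mul_inv_cancel_right]
    _ = _ := by rw [← key2]; group

end UnitUpper

/-! ### Uniform parametrization of the classes and averaging over parameters -/

section Counting

open Classical Matrix unitUpper

variable {n p : ℕ}

theorem rankOneElt_eq_iff (i : Fin (n - 1)) {c : ZMod p} (hc : IsUnit c)
    (u v u' v' : Fin n → ZMod p) :
    rankOneElt (superRow i) c u v = rankOneElt (superRow i) c u' v' ↔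
      (∀ k, k < superRow i → u k = u' k) ∧ ∀ k, superCol i < k → v k = v' k := by
  rw [← toMat_injective.eq_iff, toMat_rankOneElt, toMat_rankOneElt, add_right_inj]
  constructor
  · intro h
    constructor
    · intro k hk
      have h1 := congrFun (congrFun h k) (superCol i)
      rw [vecMulVec_apply, vecMulVec_apply, rowPart_superCol, rowPart_superCol] at h1
      have h2 := hc.mul_right_cancel h1
      rwa [colPart, colPart, if_pos hk, if_pos hk] at h2
    · intro k hk
      have h1 := congrFun (congrFun h (superRow i)) k
      rw [vecMulVec_apply, vecMulVec_apply, colPart_self, colPart_self, one_mul, one_mul] at h1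
      have hk' : (superRow i).val + 1 < k.val := hk
      rwa [rowPart, rowPart, if_pos hk', if_pos hk'] at h1
  · rintro ⟨h1, h2⟩
    congr 1
    · ext k
      unfold colPart
      split_ifs with h
      · exact h1 k h
      · rfl
      · rfl
    · ext k
      unfold rowPart
      split_ifs with h
      · exact h2 k h
      · rfl
      · rfl

theorem mem_superdiagClass_iff_rankOneElt (i : Fin (n - 1)) {c : ZMod p} (hc : IsUnit c)
    (y : unitUpper n p) :
    y ∈ superdiagClass n p i c ↔ ∃ u v, rankOneElt (superRow i) c u v = y := by
  constructor
  · intro hy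
    obtain ⟨x, rfl⟩ := (mem_superdiagClass_iff i c y).1 hy
    exact ⟨_, _, (conj_superdiagElt_eq_rankOneElt i c x).symm⟩
  · rintro ⟨u, v, rfl⟩
    exact rankOneElt_mem_superdiagClass i hc u v

variable [NeZero p]

/-- Only the entries of u before i and of v after i + 1 matter. The other n - i and i + 2 entries
(indices from 0) are free, so all fibres have the same size. The redundant full-length vectors give
every position the same parameter space. -/
theorem card_rankOneElt_fiber_of_mem (i : Fin (n - 1)) {c : ZMod p} (hc : IsUnit c)
    {y : unitUpper n p} (hy : y ∈ superdiagClass n p i c) :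
    (Finset.univ.filter fun ω : (Fin n → ZMod p) × (Fin n → ZMod p) =>
      rankOneElt (superRow i) c ω.1 ω.2 = y).card = p ^ (n + 2) := by
  obtain ⟨u, v, rfl⟩ := (mem_superdiagClass_iff_rankOneElt i hc y).1 hy
  have h : (Finset.univ.filter fun ω : (Fin n → ZMod p) × (Fin n → ZMod p) =>
      rankOneElt (superRow i) c ω.1 ω.2 = rankOneElt (superRow i) c u v) =
      (Fintype.piFinset fun k => if k < superRow i then {u k} else Finset.univ) ×ˢ
      (Fintype.piFinset fun k => if superCol i < k then {v k} else Finset.univ) := by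
    ext ω
    simp only [Finset.mem_filter, Finset.mem_univ, true_and, Finset.mem_product,
      Fintype.mem_piFinset, rankOneElt_eq_iff i hc]
    refine and_congr (forall_congr' fun k => ?_) (forall_congr' fun k => ?_)
    · split_ifs with hk <;> simp [hk]
    · split_ifs with hk <;> simp [hk]
  rw [h, Finset.card_product, Fintype.card_piFinset, Fintype.card_piFinset]
  have e1 : ∀ k, (if k < superRow i then ({u k} : Finset (ZMod p)) else Finset.univ).card =
      if k < superRow i then 1 else p := fun k => by split_ifs <;> simp [ZMod.card]
  have e2 : ∀ k, (if superCol i < k then ({v k} : Finset (ZMod p)) else Finset.univ).card =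
      if superCol i < k then 1 else p := fun k => by split_ifs <;> simp [ZMod.card]
  simp_rw [e1, e2]
  rw [Finset.prod_ite, Finset.prod_ite]
  simp only [Finset.prod_const_one, one_mul, Finset.prod_const, not_lt]
  have f1 : (Finset.univ.filter fun k : Fin n => superRow i ≤ k) = Finset.Ici (superRow i) := by
    ext; simp
  have f2 : (Finset.univ.filter fun k : Fin n => k ≤ superCol i) = Finset.Iic (superCol i) := by
    ext; simp
  rw [f1, f2, Fin.card_Ici, Fin.card_Iic, ← pow_add, superRow_val, superCol_val]
  congr 1
  have := i.2
  omega

theorem ncard_superdiagClass_mul (i : Fin (n - 1)) {c : ZMod p} (hc : IsUnit c) :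
    (superdiagClass n p i c).ncard * p ^ (n + 2) = p ^ (2 * n) := by
  have h := Finset.card_eq_sum_card_fiberwise
    (f := fun ω : (Fin n → ZMod p) × (Fin n → ZMod p) => rankOneElt (superRow i) c ω.1 ω.2)
    (s := Finset.univ) (t := (superdiagClass n p i c).toFinset) (fun ω _ => by
      simpa using rankOneElt_mem_superdiagClass i hc ω.1 ω.2)
  rw [Finset.sum_congr rfl (fun y hy => card_rankOneElt_fiber_of_mem i hc
    (Set.mem_toFinset.1 hy)), Finset.sum_const, ← Set.ncard_eq_toFinset_card', smul_eq_mul] at h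
  rw [← h]
  simp [ZMod.card, two_mul, pow_add]

theorem ncard_superdiagClass (i : Fin (n - 1)) {c : ZMod p} (hc : IsUnit c) :
    (superdiagClass n p i c).ncard = p ^ (n - 2) := by
  have h := ncard_superdiagClass_mul (n := n) i hc
  have hi := i.2
  have e : 2 * n = n - 2 + (n + 2) := by omega
  rw [e, pow_add p (n - 2)] at h
  exact Nat.eq_of_mul_eq_mul_right (pow_pos (NeZero.pos p) _) h

/-- Constant fibre size means that uniform parameters push forward to the uniform law on the class;
points outside the class have empty fibre. -/
theorem card_rankOneElt_fiber (i : Fin (n - 1)) {c : ZMod p} (hc : IsUnit c)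
    (y : unitUpper n p) :
    ((Finset.univ.filter fun ω : (Fin n → ZMod p) × (Fin n → ZMod p) =>
      rankOneElt (superRow i) c ω.1 ω.2 = y).card : ℝ) =
      (p : ℝ) ^ (2 * n) * unifOn (superdiagClass n p i c) y := by
  by_cases hy : y ∈ superdiagClass n p i c
  · rw [card_rankOneElt_fiber_of_mem i hc hy, unifOn, if_pos hy]
    have h := congrArg (Nat.cast : ℕ → ℝ) (ncard_superdiagClass_mul (n := n) i hc)
    push_cast at h
    have hpos : (0 : ℝ) < (superdiagClass n p i c).ncard := by
      exact_mod_cast (Set.ncard_pos (Set.toFinite _)).2 (superdiagClass_nonempty i c)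
    rw [← h]
    push_cast
    field_simp
  · rw [unifOn, if_neg hy, mul_zero, Finset.filter_eq_empty_iff.2]
    · simp
    · intro ω _ h
      exact hy ((mem_superdiagClass_iff_rankOneElt i hc y).2 ⟨_, _, h⟩)

/-- The right regular representation on functions, as permutation matrices. -/
noncomputable def rightReg (G : Type*) [Group G] [Fintype G] : G →* Matrix G G ℝ where
  toFun g := Matrix.of fun x y => if y = x * g then 1 else 0
  map_one' := by
    ext x y
    simp [Matrix.one_apply, eq_comm]
  map_mul' g h := by
    ext x y
    rw [Matrix.mul_apply, Finset.sum_eq_single (x * g)]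
    · simp [mul_assoc]
    · intro z _ hz
      simp [hz]
    · simp

theorem rightReg_apply {G : Type*} [Group G] [Fintype G] (g x y : G) :
    rightReg G g x y = if y = x * g then 1 else 0 := rfl

theorem walkMatrix_eq_sum_rightReg {G : Type*} [Group G] [Fintype G] (μ : G → ℝ) :
    walkMatrix μ = ∑ g, μ g • rightReg G g := by
  ext x y
  rw [Matrix.sum_apply, Finset.sum_eq_single (x⁻¹ * y)]
  · rw [Matrix.smul_apply, rightReg_apply, if_pos (mul_inv_cancel_left x y).symm, smul_eq_mul,
      mul_one, walkMatrix_apply]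
  · intro g _ hg
    rw [Matrix.smul_apply, rightReg_apply, if_neg, smul_zero]
    rintro rfl
    simp at hg
  · simp

theorem sum_rightReg_rankOneElt (i : Fin (n - 1)) {c : ZMod p} (hc : IsUnit c) :
    ∑ ω : (Fin n → ZMod p) × (Fin n → ZMod p),
      rightReg (unitUpper n p) (rankOneElt (superRow i) c ω.1 ω.2) =
      (p : ℝ) ^ (2 * n) • walkMatrix (unifOn (superdiagClass n p i c)) := by
  rw [walkMatrix_eq_sum_rightReg, Finset.smul_sum]
  rw [← Finset.sum_fiberwise (g := fun ω : (Fin n → ZMod p) × (Fin n → ZMod p) =>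
    rankOneElt (superRow i) c ω.1 ω.2)]
  refine Finset.sum_congr rfl fun y _ => ?_
  rw [Finset.sum_congr rfl (fun ω hω => by rw [(Finset.mem_filter.1 hω).2]), Finset.sum_const,
    ← Nat.cast_smul_eq_nsmul ℝ, card_rankOneElt_fiber i hc, smul_smul]

/-- Pick a sign, then a uniform element of `C_i(±1)`. -/
noncomputable def signedClassDist (n p : ℕ) (i : Fin (n - 1)) (c : ZMod p) (x : unitUpper n p) : ℝ :=
  (1 / 2) * (unifOn (superdiagClass n p i c) x + unifOn (superdiagClass n p i (-c)) x)

omit [NeZero p] in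
theorem signedClassDist_comm (i : Fin (n - 1)) (c : ZMod p) (g h : unitUpper n p) :
    signedClassDist n p i c (g * h) = signedClassDist n p i c (h * g) := by
  rw [signedClassDist, signedClassDist, unifOn_superdiagClass_comm,
    unifOn_superdiagClass_comm i (-c)]

theorem signedClassDist_isProbDist (i : Fin (n - 1)) (c : ZMod p) :
    IsProbDist (signedClassDist n p i c) := by
  have h1 := unifOn_isProbDist (superdiagClass_nonempty i c)
  have h2 := unifOn_isProbDist (superdiagClass_nonempty i (-c))
  refine ⟨fun g => ?_, ?_⟩
  · have := h1.nonneg g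
    have := h2.nonneg g
    unfold signedClassDist
    positivity
  · unfold signedClassDist
    rw [← Finset.mul_sum, Finset.sum_add_distrib, h1.sum_eq_one, h2.sum_eq_one]
    norm_num

/-- Parameters for one jump: a sign and two vectors. -/
abbrev JumpParam (n p : ℕ) := Bool × (Fin n → ZMod p) × (Fin n → ZMod p)

/-- The sign `±1` attached to a boolean. -/
def boolSign (p : ℕ) (ε : Bool) : ZMod p := if ε then 1 else -1

/-- The jump with given parameters. -/
def jumpElt (i : Fin n) (a : JumpParam n p) : unitUpper n p :=
  rankOneElt i (boolSign p a.1) a.2.1 a.2.2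

theorem sum_rightReg_jumpElt (i : Fin (n - 1)) :
    ∑ a : JumpParam n p, rightReg (unitUpper n p) (jumpElt (superRow i) a) =
      (Fintype.card (JumpParam n p) : ℝ) • walkMatrix (signedClassDist n p i 1) := by
  rw [Fintype.sum_prod_type, Fintype.sum_bool]
  simp only [jumpElt, boolSign, if_true, Bool.false_eq_true, if_false]
  rw [sum_rightReg_rankOneElt i isUnit_one,
    sum_rightReg_rankOneElt i isUnit_one.neg]
  have hc : (Fintype.card (JumpParam n p) : ℝ) = 2 * (p : ℝ) ^ (2 * n) := by
    simp [ZMod.card, two_mul, pow_add]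
  rw [hc]
  ext x y
  simp only [Matrix.add_apply, Matrix.smul_apply, walkMatrix_apply, signedClassDist, smul_eq_mul]
  ring

/-! ### Independence -/

/-- Exchanging the i-th coordinate with an independent fresh copy is an involution of the enlarged
sample space, and it does not change g. -/
theorem sum_pi_mul_of_update_eq {ι Ω M : Type*} [Fintype ι] [DecidableEq ι] [Fintype Ω]
    [Semiring M] (i : ι) (f : Ω → M) (g : (ι → Ω) → M)
    (hg : ∀ ω a, g (Function.update ω i a) = g ω) :
    (Fintype.card Ω : M) * ∑ ω : ι → Ω, f (ω i) * g ω = (∑ a, f a) * ∑ ω : ι → Ω, g ω := by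
  have h1 : (∑ a, f a) * ∑ ω : ι → Ω, g ω = ∑ x : (ι → Ω) × Ω, f x.2 * g x.1 := by
    rw [Finset.sum_mul_sum, Finset.sum_comm, Fintype.sum_prod_type]
  have h2 : (Fintype.card Ω : M) * ∑ ω : ι → Ω, f (ω i) * g ω =
      ∑ x : (ι → Ω) × Ω, f (x.1 i) * g x.1 := by
    rw [Fintype.sum_prod_type]
    simp [Finset.mul_sum]
  rw [h1, h2]
  let s : (ι → Ω) × Ω → (ι → Ω) × Ω := fun x => (Function.update x.1 i x.2, x.1 i)
  have hs : Function.Involutive s := fun x => by simp [s]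
  refine Fintype.sum_bijective s hs.bijective _ _ fun x => ?_
  simp [s, hg]

/-- The expectation of an ordered product of independent factors is the product of the expectations,
even for noncommuting values. Independence requires that no index is repeated. -/
theorem sum_pi_list_prod {ι Ω M : Type*} [Fintype ι] [DecidableEq ι] [Fintype Ω] [Nonempty Ω]
    [Ring M] [Algebra ℝ M] (f : ι → Ω → M) (m : ι → M) (l : List ι) (hl : l.Nodup)
    (hf : ∀ i ∈ l, ∑ a, f i a = (Fintype.card Ω : ℝ) • m i) :
    ∑ ω : ι → Ω, (l.map fun i => f i (ω i)).prod =
      (Fintype.card (ι → Ω) : ℝ) • (l.map m).prod := by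
  induction l with
  | nil =>
    simp only [List.map_nil, List.prod_nil, Finset.sum_const, Finset.card_univ]
    rw [← Nat.cast_smul_eq_nsmul ℝ]
  | cons i l ih =>
    rw [List.nodup_cons] at hl
    simp only [List.map_cons, List.prod_cons]
    have h := sum_pi_mul_of_update_eq (M := M) i (f i)
      (fun ω : ι → Ω => (l.map fun j => f j (ω j)).prod) (fun ω a => by
        congr 1
        refine List.map_congr_left fun j hj => ?_
        rw [Function.update_of_ne]
        rintro rfl
        exact hl.1 hj)
    rw [hf i (by simp), ih hl.2 fun j hj => hf j (by simp [hj]), smul_mul_assoc,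
      ← nsmul_eq_mul, ← Nat.cast_smul_eq_nsmul ℝ] at h
    have hcard : (Fintype.card Ω : ℝ) ≠ 0 := by positivity
    rw [(smul_right_injective M hcard) h, mul_smul_comm]

end Counting

/-! ### One jump in every position: invariance under the kernel -/

section ProductOfClasses

open Classical Matrix unitUpper

variable {n p : ℕ}

/-- Expanding the product of the I + uvᵀ, every mixed term contains a row–column pairing that
vanishes because the indices decrease. -/
theorem toMat_list_prod_jumpElt (ω : Fin n → JumpParam n p) (l : List (Fin n))
    (hl : l.Pairwise (· > ·)) :
    toMat (l.map fun i => jumpElt i (ω i)).prod =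
      1 + (l.map fun i => vecMulVec (colPart i (ω i).2.1)
        (rowPart i (boolSign p (ω i).1) (ω i).2.2)).sum := by
  induction l with
  | nil => simp [toMat_one]
  | cons i l ih =>
    rw [List.pairwise_cons] at hl
    simp only [List.map_cons, List.prod_cons, List.sum_cons]
    rw [toMat_mul, ih hl.2, jumpElt, toMat_rankOneElt, mul_add, mul_one, add_mul, one_mul]
    have h0 : vecMulVec (colPart i (ω i).2.1) (rowPart i (boolSign p (ω i).1) (ω i).2.2) *
        (l.map fun i => vecMulVec (colPart i (ω i).2.1)
          (rowPart i (boolSign p (ω i).1) (ω i).2.2)).sum = 0 := by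
      rw [← List.sum_map_mul_left]
      refine List.sum_eq_zero fun M hM => ?_
      obtain ⟨j, hj, rfl⟩ := List.mem_map.1 hM
      rw [vecMulVec_mul_vecMulVec, rowPart_dotProduct_colPart (hl.1 j hj).le, zero_smul,
        vecMulVec_zero]
    rw [h0]
    abel

/-- The matrix whose columns are the vectors `colPart i u_i`. -/
def colMat (ω : Fin n → JumpParam n p) : Matrix (Fin n) (Fin n) (ZMod p) :=
  Matrix.of fun k i => colPart i (ω i).2.1 k

/-- The matrix whose rows are the vectors `rowPart i ε_i v_i`. -/
def rowMat (ω : Fin n → JumpParam n p) : Matrix (Fin n) (Fin n) (ZMod p) :=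
  Matrix.of fun i k => rowPart i (boolSign p (ω i).1) (ω i).2.2 k

theorem colMat_isUnitUpper (ω : Fin n → JumpParam n p) : IsUnitUpper (colMat ω) :=
  ⟨fun _ _ h => colPart_of_lt _ h, fun _ => colPart_self _ _⟩

variable (n) in
/-- All superdiagonal row indices, in decreasing order. -/
def superRows : List (Fin n) := ((List.finRange (n - 1)).reverse).map superRow

theorem superRows_pairwise : (superRows n).Pairwise (· > ·) := by
  unfold superRows
  rw [List.pairwise_map, List.pairwise_reverse]
  exact (List.pairwise_lt_finRange (n - 1)).imp fun h => h

theorem superRows_nodup : (superRows n).Nodup :=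
  superRows_pairwise.imp fun h => h.ne'

theorem mem_superRows {i : Fin n} : i ∈ superRows n ↔ i.val + 1 < n := by
  unfold superRows
  simp only [List.mem_map, List.mem_reverse, List.mem_finRange, true_and]
  constructor
  · rintro ⟨j, rfl⟩
    have := j.2
    rw [superRow_val]
    omega
  · intro h
    exact ⟨⟨i.val, by omega⟩, rfl⟩

/-- The product of jumps in decreasing order of position. -/
def jumpProd (ω : Fin n → JumpParam n p) : unitUpper n p :=
  ((superRows n).map fun i => jumpElt i (ω i)).prod

theorem toMat_jumpProd (ω : Fin n → JumpParam n p) :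
    toMat (jumpProd ω) = 1 + colMat ω * rowMat ω := by
  unfold jumpProd
  rw [toMat_list_prod_jumpElt ω _ superRows_pairwise, ← List.sum_toFinset _ superRows_nodup,
    Finset.sum_subset (Finset.subset_univ _)]
  · congr 1
    ext k l
    rw [Matrix.sum_apply, Matrix.mul_apply]
    rfl
  · intro i _ hi
    rw [List.mem_toFinset, mem_superRows] at hi
    -- The only index missing from the list is the last one, where no column lies to the right of
    -- the diagonal. Adding its zero term completes the full matrix product.
    have : rowPart i (boolSign p (ω i).1) (ω i).2.2 = 0 := by
      ext k
      exact if_neg (by omega) |>.trans (if_neg (by omega))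
    rw [this, vecMulVec_zero]

/-- The column matrix as a group element. -/
def colElt (ω : Fin n → JumpParam n p) : unitUpper n p := ofMat _ (colMat_isUnitUpper ω)

/-- The change of the row matrix induced by right multiplication by `g`. -/
def shiftedRowMat (g : unitUpper n p) (ω : Fin n → JumpParam n p) :
    Matrix (Fin n) (Fin n) (ZMod p) :=
  rowMat ω * toMat g + toMat (colElt ω)⁻¹ * (toMat g - 1)

/-- The change of parameters induced by right multiplication by `g`. -/
def shiftParam (g : unitUpper n p) (ω : Fin n → JumpParam n p) : Fin n → JumpParam n p :=
  fun i => ((ω i).1, (ω i).2.1, fun k => if i.val + 1 < k.val then shiftedRowMat g ω i k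
    else (ω i).2.2 k)

theorem colMat_shiftParam (g : unitUpper n p) (ω : Fin n → JumpParam n p) :
    colMat (shiftParam g ω) = colMat ω := rfl

theorem rowMat_lower (ω : Fin n → JumpParam n p) {i k : Fin n} (h : k ≤ i) :
    rowMat ω i k = 0 := rowPart_of_le _ _ h

/-- With C and R the column and row matrices, (I + CR)g = I + C(Rg + C⁻¹(g - I)). Since g is trivial
on the superdiagonal, the bracket is again strictly upper triangular with the same signs on its
superdiagonal, hence a legitimate row matrix. -/
theorem rowMat_shiftParam (g : unitUpper n p) (hg : superdiag g = 0)
    (ω : Fin n → JumpParam n p) : rowMat (shiftParam g ω) = shiftedRowMat g ω := by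
  have hlow : ∀ i k : Fin n, k < i → (toMat g - 1) i k = 0 := fun i k h => by
    rw [Matrix.sub_apply, (isUnitUpper g).1 i k h, Matrix.one_apply_ne h.ne', sub_zero]
  have hdiag : ∀ i : Fin n, (toMat g - 1) i i = 0 := fun i => by
    rw [Matrix.sub_apply, (isUnitUpper g).2 i, Matrix.one_apply_eq, sub_self]
  ext i k
  change rowPart i _ _ k = _
  rw [rowPart]
  split_ifs with h1 h2
  · simp [shiftParam, h1]
  · have hi : i.val < n - 1 := by have := k.2; omega
    obtain ⟨j, rfl⟩ : ∃ j : Fin (n - 1), i = superRow j := ⟨⟨i.val, hi⟩, rfl⟩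
    obtain rfl : k = superCol j := Fin.ext h2
    rw [shiftedRowMat, Matrix.add_apply,
      mul_apply_superRow_superCol (fun i k h => rowMat_lower ω h.le) (isUnitUpper g).1,
      mul_apply_superRow_superCol (isUnitUpper (colElt ω)⁻¹).1 hlow, hdiag, mul_zero, add_zero,
      (isUnitUpper g).2, mul_one]
    have h3 : toMat g (superRow j) (superCol j) = 0 := congrFun hg j
    have h4 : (toMat g - 1) (superRow j) (superCol j) = 0 := by
      rw [Matrix.sub_apply, h3, Matrix.one_apply_ne, sub_zero]
      intro h
      have := congrArg Fin.val h
      simp at this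
    rw [h3, h4, mul_zero, mul_zero, zero_add, add_zero]
    exact (rowPart_superCol j _ _).symm
  · have hki : k ≤ i := by rw [Fin.le_def]; omega
    rw [shiftedRowMat, Matrix.add_apply, Matrix.mul_apply, Matrix.mul_apply,
      Finset.sum_eq_zero, Finset.sum_eq_zero, add_zero]
    · intro l _
      rcases lt_or_ge l i with h | h
      · rw [(isUnitUpper (colElt ω)⁻¹).1 _ _ h, zero_mul]
      · rcases (hki.trans h).lt_or_eq with h' | h'
        · rw [hlow _ _ h', mul_zero]
        · rw [h', hdiag, mul_zero]
    · intro l _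
      rcases le_or_gt l i with h | h
      · rw [rowMat_lower ω h, zero_mul]
      · rw [(isUnitUpper g).1 _ _ (hki.trans_lt h), mul_zero]

theorem jumpProd_shiftParam (g : unitUpper n p) (hg : superdiag g = 0)
    (ω : Fin n → JumpParam n p) : jumpProd (shiftParam g ω) = jumpProd ω * g := by
  apply toMat_injective
  rw [toMat_mul, toMat_jumpProd, toMat_jumpProd, rowMat_shiftParam g hg, colMat_shiftParam,
    shiftedRowMat, mul_add, ← mul_assoc, ← mul_assoc, add_mul, one_mul]
  have h : colMat ω * toMat (colElt ω)⁻¹ = 1 := toMat_mul_toMat_inv (colElt ω)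
  rw [h, one_mul]
  abel

/-- The shift preserves the column matrix, which is invertible, so the shifted product determines
the old row matrix. The coordinates of v that do not enter the row matrix are copied unchanged. -/
theorem shiftParam_injective (g : unitUpper n p) (hg : superdiag g = 0) :
    Function.Injective (shiftParam (p := p) g) := by
  intro ω ω' h
  have hε : ∀ i, (ω i).1 = (ω' i).1 := fun i => by
    have := congrArg Prod.fst (congrFun h i)
    exact this
  have hu : ∀ i, (ω i).2.1 = (ω' i).2.1 := fun i => by
    have := congrArg (fun a : JumpParam n p => a.2.1) (congrFun h i)
    exact this
  have hv : ∀ i k, (shiftParam g ω i).2.2 k = (shiftParam g ω' i).2.2 k := fun i k =>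
    congrArg (fun a : JumpParam n p => a.2.2 k) (congrFun h i)
  have hcol : colMat ω = colMat ω' := by
    ext k i
    simp [colMat, hu]
  have hprod : jumpProd ω = jumpProd ω' := by
    have := congrArg jumpProd h
    rw [jumpProd_shiftParam g hg, jumpProd_shiftParam g hg] at this
    exact mul_right_cancel this
  have hrow : rowMat ω = rowMat ω' := by
    have h1 := congrArg toMat hprod
    rw [toMat_jumpProd, toMat_jumpProd, add_right_inj, hcol] at h1
    have h2 := congrArg (fun M => toMat (colElt ω')⁻¹ * M) h1
    simp only [← mul_assoc] at h2
    have h3 : toMat (colElt ω')⁻¹ * colMat ω' = 1 := toMat_inv_mul_toMat (colElt ω')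
    rwa [h3, one_mul, one_mul] at h2
  funext i
  refine Prod.ext (hε i) (Prod.ext (hu i) ?_)
  funext k
  by_cases hk : i.val + 1 < k.val
  · have h1 := congrFun (congrFun hrow i) k
    simpa [rowMat, rowPart, hk] using h1
  · have h1 := hv i k
    simpa [shiftParam, hk] using h1

variable [NeZero p]

theorem sum_rightReg_jumpProd_mul (g : unitUpper n p) (hg : superdiag g = 0) :
    (∑ ω : Fin n → JumpParam n p, rightReg (unitUpper n p) (jumpProd ω)) * rightReg _ g =
      ∑ ω : Fin n → JumpParam n p, rightReg (unitUpper n p) (jumpProd ω) := by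
  rw [Finset.sum_mul]
  refine Fintype.sum_bijective (shiftParam g)
    (Finite.injective_iff_bijective.1 (shiftParam_injective g hg)) _ _ fun ω => ?_
  rw [jumpProd_shiftParam g hg, map_mul]

/-- After one jump in every superdiagonal position, the walk is uniform on cosets of the kernel of
the superdiagonal homomorphism. -/
theorem prod_walkMatrix_signedClassDist_mul :
    ((List.finRange (n - 1)).reverse.map fun i => walkMatrix (signedClassDist n p i 1)).prod *
      (1 - walkMatrix (unifOn ((superdiagHom n p).ker : Set (unitUpper n p)))) = 0 := by
  set K := (superdiagHom n p).ker with hK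
  set S := ∑ ω : Fin n → JumpParam n p, rightReg (unitUpper n p) (jumpProd ω) with hS
  -- The parameters are indexed by all n rows, whereas only n - 1 of them carry a superdiagonal
  -- position; the last row receives the dummy value 0.
  have hm : ∀ i : Fin n, ∃ M : Matrix (unitUpper n p) (unitUpper n p) ℝ,
      ∀ j : Fin (n - 1), superRow j = i → M = walkMatrix (signedClassDist n p j 1) := by
    intro i
    by_cases h : ∃ j : Fin (n - 1), superRow j = i
    · obtain ⟨j, rfl⟩ := h
      exact ⟨_, fun k hk => by rw [superRow_injective hk]⟩
    · exact ⟨0, fun j hj => absurd ⟨j, hj⟩ h⟩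
  choose m hm using hm
  have h1 : S = (Fintype.card (Fin n → JumpParam n p) : ℝ) •
      ((List.finRange (n - 1)).reverse.map fun i => walkMatrix (signedClassDist n p i 1)).prod := by
    have h2 := sum_pi_list_prod (fun i a => rightReg (unitUpper n p) (jumpElt i a)) m
      (superRows n) superRows_nodup (fun i hi => by
        obtain ⟨j, -, rfl⟩ := List.mem_map.1 hi
        rw [hm _ j rfl, sum_rightReg_jumpElt])
    rw [hS]
    refine Eq.trans (Finset.sum_congr rfl fun ω _ => ?_) (h2.trans ?_)
    · refine (map_list_prod (rightReg (unitUpper n p)) _).trans ?_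
      rw [List.map_map]
      rfl
    · unfold superRows
      rw [List.map_map]
      congr 2
      refine List.map_congr_left fun j _ => ?_
      exact hm _ j rfl
  have hc : (Fintype.card (Fin n → JumpParam n p) : ℝ) ≠ 0 := by positivity
  -- S absorbs right translation by each element of K, hence also their average.
  have h3 : S * (1 - walkMatrix (unifOn (K : Set (unitUpper n p)))) = 0 := by
    rw [mul_sub, mul_one, sub_eq_zero, walkMatrix_eq_sum_rightReg, Finset.mul_sum]
    have h4 : ∀ g : unitUpper n p, S * unifOn (K : Set (unitUpper n p)) g • rightReg _ g =
        unifOn (K : Set (unitUpper n p)) g • S := by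
      intro g
      by_cases hg : g ∈ K
      · rw [mul_smul_comm, sum_rightReg_jumpProd_mul g hg]
      · have : unifOn (K : Set (unitUpper n p)) g = 0 := by simp [unifOn, hg]
        rw [this, zero_smul, mul_zero, zero_smul]
    rw [Finset.sum_congr rfl fun g _ => h4 g, ← Finset.sum_smul,
      (unifOn_subgroup_isProbDist K).sum_eq_one, one_smul]
  rw [h1, smul_mul_assoc] at h3
  exact (smul_eq_zero.1 h3).resolve_left hc

end ProductOfClasses

/-! ### The two jump laws and the coupon-collector estimate -/

section JumpDistributions

open Classical Matrix unitUpper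

attribute [local instance] Matrix.linftyOpNormedAddCommGroup Matrix.linftyOpNormedSpace
  Matrix.linftyOpNormedRing Matrix.linftyOpNormedAlgebra

variable {n p : ℕ}

/-- Pick a position uniformly, `c` uniformly from `1, -1, b, -b`, and a uniform element of the
class. -/
noncomputable def signedJumpDist (n p : ℕ) (b : ZMod p) (x : unitUpper n p) : ℝ :=
  ∑ i : Fin (n - 1), 1 / (2 * ((n : ℝ) - 1)) *
    (signedClassDist n p i 1 x + signedClassDist n p i b x)

theorem jumpNu_eq (n p : ℕ) : jumpNu n p = signedJumpDist n p (jumpSize p : ZMod p) := by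
  ext x
  unfold jumpNu signedJumpDist signedClassDist
  refine Finset.sum_congr rfl fun i _ => ?_
  rw [show (4 * ((n : ℝ) - 1)) = 2 * (2 * ((n : ℝ) - 1)) by ring, one_div, one_div, mul_inv]
  ring

/-- The superdiagonal distinguishes the classes C_i(±1), since 1 ≠ -1 once p ≥ 3. They are therefore
disjoint, all of size p^(n-2), and the uniform law on the union is the mixture of the uniform laws.
-/
theorem jumpMu_eq (hp : 3 ≤ p) (n : ℕ) : jumpMu n p = signedJumpDist n p 1 := by
  have : NeZero p := ⟨by omega⟩
  have : Fact (2 < p) := ⟨by omega⟩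
  have hne : (1 : ZMod p) ≠ -1 := (ZMod.neg_one_ne_one).symm
  have hdisj : ∀ {i j : Fin (n - 1)} {c d : ZMod p} {x : unitUpper n p},
      x ∈ superdiagClass n p i c → (i, c) ≠ (j, d) → IsUnit c → x ∉ superdiagClass n p j d := by
    intro i j c d x hx hij hc hx'
    have h := (superdiag_of_mem_superdiagClass hx).symm.trans
      (superdiag_of_mem_superdiagClass hx')
    have : Nontrivial (ZMod p) := ZMod.nontrivial_iff.2 (by omega)
    by_cases hijj : i = j
    · subst hijj
      exact hij (by rw [Pi.single_injective i h])
    · have := congrFun h i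
      rw [Pi.single_eq_same, Pi.single_eq_of_ne hijj] at this
      exact hc.ne_zero this
  have hval : ∀ {i : Fin (n - 1)} {c : ZMod p} {x : unitUpper n p}, (c = 1 ∨ c = -1) →
      x ∈ superdiagClass n p i c → signedClassDist n p i 1 x = 1 / (2 * (p : ℝ) ^ (n - 2)) ∧
        ∀ j ≠ i, signedClassDist n p j 1 x = 0 := by
    intro i c x hc hx
    have hcu : IsUnit c := by
      rcases hc with rfl | rfl
      · exact isUnit_one
      · exact isUnit_one.neg
    have hu : unifOn (superdiagClass n p i c) x = 1 / (p : ℝ) ^ (n - 2) := by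
      rw [unifOn, if_pos hx, ncard_superdiagClass i hcu]
      push_cast
      rfl
    have hz : ∀ j d, (i, c) ≠ (j, d) → unifOn (superdiagClass n p j d) x = 0 := fun j d h => by
      rw [unifOn, if_neg (hdisj hx h hcu)]
    constructor
    · unfold signedClassDist
      rcases hc with rfl | rfl
      · rw [hu, hz i (-1) (by simpa using hne)]
        field_simp
        ring
      · rw [hu, hz i 1 (by simpa using hne.symm)]
        field_simp
        ring
    · intro j hj
      unfold signedClassDist
      rw [hz j 1 (by simp [hj.symm]), hz j (-1) (by simp [hj.symm])]
      simp
  ext x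
  unfold jumpMu signedJumpDist
  split_ifs with hx
  · obtain ⟨i, hi⟩ := Set.mem_iUnion.1 hx
    obtain ⟨c, hc, hxc⟩ : ∃ c : ZMod p, (c = 1 ∨ c = -1) ∧ x ∈ superdiagClass n p i c := by
      rcases hi with hi | hi
      · exact ⟨1, Or.inl rfl, hi⟩
      · exact ⟨-1, Or.inr rfl, hi⟩
    obtain ⟨h1, h2⟩ := hval hc hxc
    rw [Finset.sum_eq_single i (fun j _ hj => by rw [h2 j hj]; simp) (by simp), h1]
    have := i.2
    have hn : (n : ℝ) - 1 ≠ 0 := by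
      have : (2 : ℝ) ≤ n := by exact_mod_cast (by omega : 2 ≤ n)
      linarith
    have hp' : (p : ℝ) ≠ 0 := by exact_mod_cast (NeZero.ne p)
    field_simp
    ring
  · refine (Finset.sum_eq_zero fun i _ => ?_).symm
    simp only [Set.mem_iUnion, not_exists, Set.mem_union, not_or] at hx
    rw [signedClassDist, unifOn, unifOn, if_neg (hx i).1, if_neg (hx i).2]
    simp

variable [NeZero p]

theorem signedJumpDist_isProbDist (hn : 2 ≤ n) (b : ZMod p) :
    IsProbDist (signedJumpDist n p b) := by
  have hn' : (0 : ℝ) < (n : ℝ) - 1 := by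
    have : (2 : ℝ) ≤ n := by exact_mod_cast hn
    linarith
  refine ⟨fun g => ?_, ?_⟩
  · refine Finset.sum_nonneg fun i _ => mul_nonneg (by positivity) (add_nonneg ?_ ?_)
    · exact (signedClassDist_isProbDist i 1).nonneg g
    · exact (signedClassDist_isProbDist i b).nonneg g
  · unfold signedJumpDist
    rw [Finset.sum_comm]
    simp_rw [← Finset.mul_sum, Finset.sum_add_distrib]
    simp only [(signedClassDist_isProbDist _ _).sum_eq_one, Finset.sum_const, Finset.card_univ,
      Fintype.card_fin, nsmul_eq_mul]
    rw [Nat.cast_sub (by omega)]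
    push_cast
    field_simp
    norm_num

omit [NeZero p] in
-- Poisson thinning: each position receives its ±1 jumps and its ±b jumps from separate clocks, each
-- run for time t/(2(n-1)).
theorem smul_walkMatrix_signedJumpDist_sub_one (hn : 2 ≤ n) (b : ZMod p) (t : ℝ) :
    t • (walkMatrix (signedJumpDist n p b) - 1) =
      ((List.finRange (n - 1)).reverse.map fun i =>
        (t / (2 * ((n : ℝ) - 1))) • (walkMatrix (signedClassDist n p i 1) - 1)).sum +
      ((List.finRange (n - 1)).reverse.map fun i =>
        (t / (2 * ((n : ℝ) - 1))) • (walkMatrix (signedClassDist n p i b) - 1)).sum := by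
  have hn' : (0 : ℝ) < (n : ℝ) - 1 := by
    have : (2 : ℝ) ≤ n := by exact_mod_cast hn
    linarith
  have hl : ∀ f : Fin (n - 1) → Matrix (unitUpper n p) (unitUpper n p) ℝ,
      ((List.finRange (n - 1)).reverse.map f).sum = ∑ i, f i := fun f => by
    rw [List.map_reverse, List.sum_reverse, ← List.ofFn_eq_map, List.sum_ofFn]
  rw [hl, hl, ← Finset.sum_add_distrib]
  ext x y
  simp only [Matrix.smul_apply, Matrix.sub_apply, Matrix.sum_apply, Matrix.add_apply,
    walkMatrix_apply, signedJumpDist, smul_eq_mul]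
  have e : ∀ i : Fin (n - 1), t / (2 * ((n : ℝ) - 1)) * (signedClassDist n p i 1 (x⁻¹ * y) -
      (1 : Matrix (unitUpper n p) (unitUpper n p) ℝ) x y) + t / (2 * ((n : ℝ) - 1)) *
      (signedClassDist n p i b (x⁻¹ * y) - (1 : Matrix (unitUpper n p) (unitUpper n p) ℝ) x y) =
      t * (1 / (2 * ((n : ℝ) - 1)) * (signedClassDist n p i 1 (x⁻¹ * y) +
        signedClassDist n p i b (x⁻¹ * y))) - t / ((n : ℝ) - 1) *
        (1 : Matrix (unitUpper n p) (unitUpper n p) ℝ) x y := fun i => by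
    field_simp
    ring
  rw [Finset.sum_congr rfl fun i _ => e i, Finset.sum_sub_distrib, ← Finset.mul_sum,
    Finset.sum_const, Finset.card_univ, Fintype.card_fin, nsmul_eq_mul, Nat.cast_sub (by omega),
    Nat.cast_one, ← mul_assoc, mul_div_cancel₀ _ hn'.ne', mul_sub, Finset.mul_sum,
    Finset.mul_sum]

theorem walkMatrix_signedClassDist_commute (i j : Fin (n - 1)) (c d : ZMod p) :
    Commute (walkMatrix (signedClassDist n p i c)) (walkMatrix (signedClassDist n p j d)) :=
  walkMatrix_commute (signedClassDist_comm j d)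

theorem norm_one_sub_walkMatrix_ker_le :
    ‖1 - walkMatrix (unifOn ((superdiagHom n p).ker : Set (unitUpper n p)))‖ ≤ 2 := by
  refine (norm_sub_le _ _).trans ?_
  have h1 : ‖(1 : Matrix (unitUpper n p) (unitUpper n p) ℝ)‖ = 1 := norm_one
  have h2 := (unifOn_subgroup_isProbDist (superdiagHom n p).ker).norm_walkMatrix_le_one
  rw [h1]
  linarith

/-- Coupon-collector bound on the distance to uniformity inside cosets of the kernel. -/
theorem norm_exp_signedJumpDist_mul_le (hn : 2 ≤ n) (b : ZMod p) {t : ℝ} (ht : 0 ≤ t) :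
    ‖NormedSpace.exp (t • (walkMatrix (signedJumpDist n p b) - 1)) *
      (1 - walkMatrix (unifOn ((superdiagHom n p).ker : Set (unitUpper n p))))‖ ≤
      2 * (((n : ℝ) - 1) * Real.exp (-(t / (2 * ((n : ℝ) - 1))))) := by
  have hn' : (0 : ℝ) < (n : ℝ) - 1 := by
    have : (2 : ℝ) ≤ n := by exact_mod_cast hn
    linarith
  have hσ : 0 ≤ t / (2 * ((n : ℝ) - 1)) := by positivity
  set σ := t / (2 * ((n : ℝ) - 1)) with hσd
  set l := (List.finRange (n - 1)).reverse with hl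
  set X := (l.map fun i => σ • (walkMatrix (signedClassDist n p i 1) - 1)).sum with hX
  set Y := (l.map fun i => σ • (walkMatrix (signedClassDist n p i b) - 1)).sum with hY
  have hcomm : Commute Y X := by
    refine Commute.list_sum_left _ _ fun x hx => ?_
    obtain ⟨i, -, rfl⟩ := List.mem_map.1 hx
    refine Commute.list_sum_right _ _ fun y hy => ?_
    obtain ⟨j, -, rfl⟩ := List.mem_map.1 hy
    exact (((walkMatrix_signedClassDist_commute i j b 1).sub_right
      (Commute.one_right _)).sub_left (Commute.one_left _)).smul_left σ |>.smul_right σ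
  rw [smul_walkMatrix_signedJumpDist_sub_one hn b t, ← hX, ← hY, add_comm]
  have hexp : NormedSpace.exp (Y + X) = NormedSpace.exp Y * NormedSpace.exp X :=
    exp_add_of_commute_real (A := Matrix (unitUpper n p) (unitUpper n p) ℝ) hcomm
  rw [hexp, mul_assoc]
  -- The ±b jumps are used only as a contraction: b need not be a unit mod p, so C_i(b) may lack the
  -- rank-one parametrization.
  have h1 : ‖NormedSpace.exp Y‖ ≤ 1 :=
    norm_exp_list_sum_le_one (A := Matrix (unitUpper n p) (unitUpper n p) ℝ) _
      (fun i j => walkMatrix_signedClassDist_commute i j b b)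
      (fun i => (signedClassDist_isProbDist i b).norm_walkMatrix_le_one) hσ l
  have h2 := norm_exp_list_sum_mul_le (A := Matrix (unitUpper n p) (unitUpper n p) ℝ) _
      (fun i j => walkMatrix_signedClassDist_commute i j 1 1)
      (fun i => (signedClassDist_isProbDist i 1).norm_walkMatrix_le_one) hσ l _
      prod_walkMatrix_signedClassDist_mul
  have hlen : (l.length : ℝ) = (n : ℝ) - 1 := by
    rw [hl, List.length_reverse, List.length_finRange, Nat.cast_sub (by omega)]
    norm_num
  rw [hlen] at h2
  have h3 := norm_one_sub_walkMatrix_ker_le (n := n) (p := p)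
  calc _ ≤ ‖NormedSpace.exp Y‖ * ‖NormedSpace.exp X *
        (1 - walkMatrix (unifOn ((superdiagHom n p).ker : Set (unitUpper n p))))‖ :=
        norm_mul_le _ _
    _ ≤ 1 * (((n : ℝ) - 1) * Real.exp (-σ) * 2) := by
        refine mul_le_mul h1 (h2.trans ?_) (norm_nonneg _) zero_le_one
        gcongr
    _ = _ := by ring

/-- The coupon-collector bound for the walk whose jumps all lie in the classes `C_i(±1)`. -/
theorem norm_exp_signedJumpDist_one_mul_le (hn : 2 ≤ n) {t : ℝ} (ht : 0 ≤ t) :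
    ‖NormedSpace.exp (t • (walkMatrix (signedJumpDist n p 1) - 1)) *
      (1 - walkMatrix (unifOn ((superdiagHom n p).ker : Set (unitUpper n p))))‖ ≤
      2 * (((n : ℝ) - 1) * Real.exp (-(t / ((n : ℝ) - 1)))) := by
  have hn' : (0 : ℝ) < (n : ℝ) - 1 := by
    have : (2 : ℝ) ≤ n := by exact_mod_cast hn
    linarith
  have hσ : 0 ≤ t / ((n : ℝ) - 1) := by positivity
  set l := (List.finRange (n - 1)).reverse with hl
  have h2 := norm_exp_list_sum_mul_le (A := Matrix (unitUpper n p) (unitUpper n p) ℝ) _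
      (fun i j => walkMatrix_signedClassDist_commute i j 1 1)
      (fun i => (signedClassDist_isProbDist i 1).norm_walkMatrix_le_one) hσ l _
      prod_walkMatrix_signedClassDist_mul
  have hlen : (l.length : ℝ) = (n : ℝ) - 1 := by
    rw [hl, List.length_reverse, List.length_finRange, Nat.cast_sub (by omega)]
    norm_num
  have hX : t • (walkMatrix (signedJumpDist n p 1) - 1) =
      (l.map fun i => (t / ((n : ℝ) - 1)) • (walkMatrix (signedClassDist n p i 1) - 1)).sum := by
    rw [smul_walkMatrix_signedJumpDist_sub_one hn 1 t, ← List.sum_map_add]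
    congr 2
    funext i
    rw [← add_smul]
    congr 1
    field_simp
    norm_num
  rw [hX]
  rw [hlen] at h2
  have h3 := norm_one_sub_walkMatrix_ker_le (n := n) (p := p)
  calc _ ≤ ((n : ℝ) - 1) * Real.exp (-(t / ((n : ℝ) - 1))) * 2 := h2.trans (by gcongr)
    _ = _ := by ring

end JumpDistributions

/-! ### Fourier analysis of the superdiagonal walk -/

section Fourier

open Classical Matrix unitUpper

variable {n p : ℕ} [NeZero p]

/-- The function `x ↦ cos(2πx/p)` on `ℤ/pℤ`. -/
noncomputable def zmodCos (x : ZMod p) : ℝ := (ZMod.stdAddChar x : ℂ).re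

/-- The function `x ↦ sin(2πx/p)` on `ℤ/pℤ`. -/
noncomputable def zmodSin (x : ZMod p) : ℝ := (ZMod.stdAddChar x : ℂ).im

theorem zmodCos_add (x y : ZMod p) :
    zmodCos (x + y) = zmodCos x * zmodCos y - zmodSin x * zmodSin y := by
  unfold zmodCos zmodSin
  rw [AddChar.map_add_eq_mul, Complex.mul_re]

theorem zmodSin_add (x y : ZMod p) :
    zmodSin (x + y) = zmodCos x * zmodSin y + zmodSin x * zmodCos y := by
  unfold zmodCos zmodSin
  rw [AddChar.map_add_eq_mul, Complex.mul_im]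

theorem zmodCos_sq_add_zmodSin_sq (x : ZMod p) : zmodCos x ^ 2 + zmodSin x ^ 2 = 1 := by
  have h : ‖(ZMod.stdAddChar x : ℂ)‖ = 1 := by
    rw [ZMod.stdAddChar_apply]
    exact Circle.norm_coe _
  have h2 := Complex.sq_norm (ZMod.stdAddChar x : ℂ)
  rw [h, Complex.normSq_apply] at h2
  unfold zmodCos zmodSin
  linarith

@[simp]
theorem zmodCos_zero : zmodCos (0 : ZMod p) = 1 := by simp [zmodCos]

@[simp]
theorem zmodSin_zero : zmodSin (0 : ZMod p) = 0 := by simp [zmodSin]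

theorem zmodCos_natCast (k : ℕ) : zmodCos (k : ZMod p) = Real.cos (2 * Real.pi * k / p) := by
  have h := ZMod.stdAddChar_coe (N := p) (k : ℤ)
  unfold zmodCos
  rw [Int.cast_natCast] at h
  rw [h]
  have e : (2 * (Real.pi : ℂ) * Complex.I * ((k : ℤ) : ℂ) / (p : ℂ)) =
      ((2 * Real.pi * k / p : ℝ) : ℂ) * Complex.I := by
    push_cast
    ring
  rw [e, Complex.exp_ofReal_mul_I_re]

theorem zmodCos_neg (x : ZMod p) : zmodCos (-x) = zmodCos x := by
  have h1 := zmodCos_add x (-x)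
  have h2 := zmodSin_add x (-x)
  rw [add_neg_cancel] at h1 h2
  rw [zmodCos_zero] at h1
  rw [zmodSin_zero] at h2
  have h3 := zmodCos_sq_add_zmodSin_sq x
  linear_combination (zmodCos (-x)) * (-h3) - zmodCos x * h1 - zmodSin x * h2

theorem zmodSin_neg (x : ZMod p) : zmodSin (-x) = -zmodSin x := by
  have h1 := zmodCos_add x (-x)
  have h2 := zmodSin_add x (-x)
  rw [add_neg_cancel] at h1 h2
  rw [zmodCos_zero] at h1
  rw [zmodSin_zero] at h2
  have h3 := zmodCos_sq_add_zmodSin_sq x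
  linear_combination (zmodSin (-x)) * (-h3) - zmodCos x * h2 + zmodSin x * h1

theorem zmodCos_mul_zmodCos (x y : ZMod p) :
    zmodCos x * zmodCos y = (1 / 2) * (zmodCos (x + y) + zmodCos (x - y)) := by
  rw [sub_eq_add_neg, zmodCos_add, zmodCos_add, zmodCos_neg, zmodSin_neg]
  ring

theorem zmodCos_sq_le_one (x : ZMod p) : zmodCos x ^ 2 ≤ 1 := by
  have := zmodCos_sq_add_zmodSin_sq x
  nlinarith [sq_nonneg (zmodSin x)]

/-- Spectral gap of the character `κ` for the walk on `ℤ/pℤ` with jumps `±1, ±b`. -/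
noncomputable def charGap (b κ : ZMod p) : ℝ := 1 - (zmodCos κ + zmodCos (b * κ)) / 2

@[simp]
theorem charGap_zero (b : ZMod p) : charGap b 0 = 0 := by simp [charGap]

@[simp]
theorem charGap_neg (b κ : ZMod p) : charGap b (-κ) = charGap b κ := by
  rw [charGap, charGap, mul_neg, zmodCos_neg, zmodCos_neg]

theorem sum_unifOn_superdiagClass_mul (i : Fin (n - 1)) (c : ZMod p)
    (f : (Fin (n - 1) → ZMod p) → ℝ) :
    ∑ g, unifOn (superdiagClass n p i c) g * f (superdiag g) = f (Pi.single i c) := by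
  have h : ∀ g, unifOn (superdiagClass n p i c) g * f (superdiag g) =
      unifOn (superdiagClass n p i c) g * f (Pi.single i c) := by
    intro g
    by_cases hg : g ∈ superdiagClass n p i c
    · rw [superdiag_of_mem_superdiagClass hg]
    · have : unifOn (superdiagClass n p i c) g = 0 := by simp [unifOn, hg]
      rw [this, zero_mul, zero_mul]
  rw [Finset.sum_congr rfl fun g _ => h g, ← Finset.sum_mul,
    (unifOn_isProbDist (superdiagClass_nonempty i c)).sum_eq_one, one_mul]

theorem sum_signedJumpDist_mul (b : ZMod p) (f : (Fin (n - 1) → ZMod p) → ℝ) :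
    ∑ g, signedJumpDist n p b g * f (superdiag g) =
      ∑ i : Fin (n - 1), 1 / (4 * ((n : ℝ) - 1)) * (f (Pi.single i 1) + f (Pi.single i (-1)) +
        f (Pi.single i b) + f (Pi.single i (-b))) := by
  unfold signedJumpDist
  simp_rw [Finset.sum_mul]
  rw [Finset.sum_comm]
  refine Finset.sum_congr rfl fun i _ => ?_
  rw [← sum_unifOn_superdiagClass_mul i 1 f, ← sum_unifOn_superdiagClass_mul i (-1) f,
    ← sum_unifOn_superdiagClass_mul i b f, ← sum_unifOn_superdiagClass_mul i (-b) f,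
    ← Finset.sum_add_distrib, ← Finset.sum_add_distrib, ← Finset.sum_add_distrib, Finset.mul_sum]
  refine Finset.sum_congr rfl fun g _ => ?_
  unfold signedClassDist
  rw [show (4 * ((n : ℝ) - 1)) = 2 * (2 * ((n : ℝ) - 1)) by ring, one_div (2 * (2 * _)),
    mul_inv, one_div (2 * _)]
  ring

/-- The eigenvalue of the walk at the character `k`. -/
noncomputable def walkEigenvalue (b : ZMod p) (k : Fin (n - 1) → ZMod p) : ℝ :=
  1 - (∑ i, charGap b (k i)) / ((n : ℝ) - 1)

theorem sum_signedJumpDist_mul_zmodCos (hn : 2 ≤ n) (b : ZMod p) (k : Fin (n - 1) → ZMod p) :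
    ∑ g, signedJumpDist n p b g * zmodCos (k ⬝ᵥ superdiag g) = walkEigenvalue b k := by
  have hn' : (0 : ℝ) < (n : ℝ) - 1 := by
    have : (2 : ℝ) ≤ n := by exact_mod_cast hn
    linarith
  rw [sum_signedJumpDist_mul b fun w => zmodCos (k ⬝ᵥ w)]
  simp only [dotProduct_single, mul_neg, zmodCos_neg, mul_one]
  have e : ∀ i : Fin (n - 1), 1 / (4 * ((n : ℝ) - 1)) * (zmodCos (k i) + zmodCos (k i) +
      zmodCos (k i * b) + zmodCos (k i * b)) = 1 / ((n : ℝ) - 1) -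
        charGap b (k i) / ((n : ℝ) - 1) := by
    intro i
    rw [charGap, mul_comm b]
    field_simp
    ring
  rw [Finset.sum_congr rfl fun i _ => e i, Finset.sum_sub_distrib, Finset.sum_const, Finset.card_univ, Fintype.card_fin, nsmul_eq_mul, Nat.cast_sub (by omega),
    walkEigenvalue, Nat.cast_one, mul_one_div_cancel hn'.ne', ← Finset.sum_div]

/-- The jump law is symmetric on the superdiagonal. The vanishing sine moment removes the cross
terms in the addition formulas, so that cosine and sine are separately eigenfunctions with the same
real eigenvalue. -/
theorem sum_signedJumpDist_mul_zmodSin (b : ZMod p) (k : Fin (n - 1) → ZMod p) :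
    ∑ g, signedJumpDist n p b g * zmodSin (k ⬝ᵥ superdiag g) = 0 := by
  rw [sum_signedJumpDist_mul b fun w => zmodSin (k ⬝ᵥ w)]
  simp only [dotProduct_single, mul_neg, zmodSin_neg, mul_one]
  refine Finset.sum_eq_zero fun i _ => by ring

theorem walkMatrix_mulVec_zmodCos (hn : 2 ≤ n) (b : ZMod p) (k : Fin (n - 1) → ZMod p) :
    walkMatrix (signedJumpDist n p b) *ᵥ (fun g => zmodCos (k ⬝ᵥ superdiag g)) =
      walkEigenvalue b k • fun g => zmodCos (k ⬝ᵥ superdiag g) := by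
  ext x
  change ∑ y, signedJumpDist n p b (x⁻¹ * y) * zmodCos (k ⬝ᵥ superdiag y) =
    walkEigenvalue b k * zmodCos (k ⬝ᵥ superdiag x)
  have h : ∑ y, signedJumpDist n p b (x⁻¹ * y) * zmodCos (k ⬝ᵥ superdiag y) =
      ∑ g, signedJumpDist n p b g * zmodCos (k ⬝ᵥ superdiag (x * g)) :=
    Fintype.sum_equiv (Equiv.mulLeft x⁻¹) _ _ fun y => by simp
  rw [h]
  simp_rw [superdiag_mul, dotProduct_add, zmodCos_add, mul_sub, ← mul_assoc,
    mul_comm _ (zmodCos (k ⬝ᵥ superdiag x)), mul_comm _ (zmodSin (k ⬝ᵥ superdiag x)), mul_assoc]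
  rw [Finset.sum_sub_distrib, ← Finset.mul_sum, ← Finset.mul_sum,
    sum_signedJumpDist_mul_zmodCos hn, sum_signedJumpDist_mul_zmodSin]
  ring

theorem walkMatrix_mulVec_zmodSin (hn : 2 ≤ n) (b : ZMod p) (k : Fin (n - 1) → ZMod p) :
    walkMatrix (signedJumpDist n p b) *ᵥ (fun g => zmodSin (k ⬝ᵥ superdiag g)) =
      walkEigenvalue b k • fun g => zmodSin (k ⬝ᵥ superdiag g) := by
  ext x
  change ∑ y, signedJumpDist n p b (x⁻¹ * y) * zmodSin (k ⬝ᵥ superdiag y) =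
    walkEigenvalue b k * zmodSin (k ⬝ᵥ superdiag x)
  have h : ∑ y, signedJumpDist n p b (x⁻¹ * y) * zmodSin (k ⬝ᵥ superdiag y) =
      ∑ g, signedJumpDist n p b g * zmodSin (k ⬝ᵥ superdiag (x * g)) :=
    Fintype.sum_equiv (Equiv.mulLeft x⁻¹) _ _ fun y => by simp
  rw [h]
  simp_rw [superdiag_mul, dotProduct_add, zmodSin_add, mul_add, ← mul_assoc,
    mul_comm _ (zmodCos (k ⬝ᵥ superdiag x)), mul_comm _ (zmodSin (k ⬝ᵥ superdiag x)), mul_assoc]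
  rw [Finset.sum_add_distrib, ← Finset.mul_sum, ← Finset.mul_sum,
    sum_signedJumpDist_mul_zmodCos hn, sum_signedJumpDist_mul_zmodSin]
  ring

theorem sum_heatKernel_mul_zmodCos (hn : 2 ≤ n) (b : ZMod p) (k : Fin (n - 1) → ZMod p) (t : ℝ) :
    ∑ y, heatKernel (signedJumpDist n p b) t 1 y * zmodCos (k ⬝ᵥ superdiag y) =
      Real.exp (-(t / ((n : ℝ) - 1) * ∑ i, charGap b (k i))) := by
  rw [sum_heatKernel_mul_of_eigenvector (walkMatrix_mulVec_zmodCos hn b k), superdiag_one,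
    dotProduct_zero, zmodCos_zero, mul_one, walkEigenvalue]
  congr 1
  ring

theorem sum_heatKernel_mul_zmodSin (hn : 2 ≤ n) (b : ZMod p) (k : Fin (n - 1) → ZMod p) (t : ℝ) :
    ∑ y, heatKernel (signedJumpDist n p b) t 1 y * zmodSin (k ⬝ᵥ superdiag y) = 0 := by
  rw [sum_heatKernel_mul_of_eigenvector (walkMatrix_mulVec_zmodSin hn b k), superdiag_one,
    dotProduct_zero, zmodSin_zero, mul_zero]

theorem addChar_map_sum {ι A M : Type*} [AddCommMonoid A] [CommMonoid M] (ψ : AddChar A M)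
    (s : Finset ι) (f : ι → A) : ψ (∑ i ∈ s, f i) = ∏ i ∈ s, ψ (f i) := by
  induction s using Finset.induction_on with
  | empty => simp
  | insert i s hi ih => rw [Finset.sum_insert hi, Finset.prod_insert hi, AddChar.map_add_eq_mul, ih]

theorem sum_zmodCos_dotProduct {ι : Type*} [Fintype ι] [DecidableEq ι] (w : ι → ZMod p) :
    ∑ k : ι → ZMod p, zmodCos (k ⬝ᵥ w) = if w = 0 then (p : ℝ) ^ Fintype.card ι else 0 := by
  have h : ∑ k : ι → ZMod p, (ZMod.stdAddChar (k ⬝ᵥ w) : ℂ) =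
      if w = 0 then (p : ℂ) ^ Fintype.card ι else 0 := by
    have h1 : ∀ k : ι → ZMod p, (ZMod.stdAddChar (k ⬝ᵥ w) : ℂ) =
        ∏ i, (ZMod.stdAddChar (k i * w i) : ℂ) := fun k => by
      rw [dotProduct, addChar_map_sum]
    simp_rw [h1]
    rw [← Fintype.prod_sum fun i (κ : ZMod p) => (ZMod.stdAddChar (κ * w i) : ℂ)]
    simp_rw [AddChar.sum_mulShift _ (ZMod.isPrimitive_stdAddChar p), ZMod.card]
    split_ifs with hw
    · simp [hw]
    · obtain ⟨i, hi⟩ := Function.ne_iff.1 hw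
      refine Finset.prod_eq_zero (Finset.mem_univ i) ?_
      rw [if_neg (by simpa using hi), Nat.cast_zero]
  have h2 := congrArg Complex.re h
  rw [Complex.re_sum] at h2
  refine h2.trans ?_
  split_ifs
  · rw [← Nat.cast_pow, Complex.natCast_re, Nat.cast_pow]
  · rfl

/-- On the kernel the left side is the index of K, at most p^(n-1) because the quotient embeds in
(ℤ/p)^(n-1). The right side is the character expansion of p^(n-1) times the indicator. Surjectivity
of the superdiagonal is not needed. -/
theorem card_mul_unifOn_ker_le (g : unitUpper n p) :
    (Fintype.card (unitUpper n p) : ℝ) *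
      unifOn ((superdiagHom n p).ker : Set (unitUpper n p)) g ≤
      ∑ k : Fin (n - 1) → ZMod p, zmodCos (k ⬝ᵥ superdiag g) := by
  rw [sum_zmodCos_dotProduct, Fintype.card_fin]
  by_cases hg : superdiag g = 0
  · have hg' : g ∈ ((superdiagHom n p).ker : Set (unitUpper n p)) := hg
    rw [if_pos hg, unifOn, if_pos hg']
    have h1 := (superdiagHom n p).ker.card_mul_index
    rw [Subgroup.index_ker] at h1
    have h2 : Nat.card (superdiagHom n p).range ≤ p ^ (n - 1) := by
      refine (Subgroup.card_le_card_group _).trans (le_of_eq ?_)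
      rw [Nat.card_eq_fintype_card, Fintype.card_multiplicative, Fintype.card_fun, ZMod.card,
        Fintype.card_fin]
    have h3 : ((superdiagHom n p).ker : Set (unitUpper n p)).ncard =
        Nat.card (superdiagHom n p).ker := rfl
    have h4 : 0 < Nat.card (superdiagHom n p).ker := Nat.card_pos
    rw [← Nat.card_eq_fintype_card, ← h1, h3, mul_one_div, div_le_iff₀ (by exact_mod_cast h4)]
    rw [mul_comm]
    exact_mod_cast Nat.mul_le_mul_right _ h2
  · have hg' : g ∉ ((superdiagHom n p).ker : Set (unitUpper n p)) := hg
    rw [if_neg hg, unifOn, if_neg hg', mul_zero]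

/-- Each character contributes the square of its heat eigenvalue. The exponent is additive over
coordinates, so the sum over all characters factors into n - 1 equal sums over ℤ/p. -/
theorem card_mul_sum_heatKernel_le (hn : 2 ≤ n) (b : ZMod p) {t : ℝ} (ht : 0 ≤ t) :
    (Fintype.card (unitUpper n p) : ℝ) * (∑ z, ∑ z', heatKernel (signedJumpDist n p b) t 1 z *
      heatKernel (signedJumpDist n p b) t 1 z' *
        unifOn ((superdiagHom n p).ker : Set (unitUpper n p)) (z⁻¹ * z')) ≤
      (∑ κ : ZMod p, Real.exp (-(2 * (t / ((n : ℝ) - 1)) * charGap b κ))) ^ (n - 1) := by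
  set h := heatKernel (signedJumpDist n p b) t 1 with hh
  have h0 : ∀ z, 0 ≤ h z := fun z =>
    heatKernel_nonneg (signedJumpDist_isProbDist hn b) ht 1 z
  have hsq : ∀ k : Fin (n - 1) → ZMod p,
      ∑ z, ∑ z', h z * h z' * zmodCos (k ⬝ᵥ superdiag (z⁻¹ * z')) =
        ∏ i, Real.exp (-(2 * (t / ((n : ℝ) - 1)) * charGap b (k i))) := by
    intro k
    have e : ∀ z z', h z * h z' * zmodCos (k ⬝ᵥ superdiag (z⁻¹ * z')) =
        (h z * zmodCos (k ⬝ᵥ superdiag z)) * (h z' * zmodCos (k ⬝ᵥ superdiag z')) +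
        (h z * zmodSin (k ⬝ᵥ superdiag z)) * (h z' * zmodSin (k ⬝ᵥ superdiag z')) := by
      intro z z'
      rw [superdiag_mul, superdiag_inv, dotProduct_add, dotProduct_neg, zmodCos_add, zmodCos_neg,
        zmodSin_neg]
      ring
    simp_rw [e, Finset.sum_add_distrib]
    rw [← Finset.sum_mul_sum, ← Finset.sum_mul_sum, hh, sum_heatKernel_mul_zmodCos hn,
      sum_heatKernel_mul_zmodSin hn, ← Real.exp_add, mul_zero, add_zero, ← Real.exp_sum]
    congr 1
    rw [Finset.sum_neg_distrib, ← Finset.mul_sum]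
    ring
  calc _ = ∑ z, ∑ z', h z * h z' * ((Fintype.card (unitUpper n p) : ℝ) *
        unifOn ((superdiagHom n p).ker : Set (unitUpper n p)) (z⁻¹ * z')) := by
        rw [Finset.mul_sum]
        refine Finset.sum_congr rfl fun z _ => ?_
        rw [Finset.mul_sum]
        exact Finset.sum_congr rfl fun z' _ => by ring
    _ ≤ ∑ z, ∑ z', h z * h z' * ∑ k : Fin (n - 1) → ZMod p,
          zmodCos (k ⬝ᵥ superdiag (z⁻¹ * z')) := by
        gcongr with z _ z' _
        · exact mul_nonneg (h0 z) (h0 z')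
        · exact card_mul_unifOn_ker_le _
    _ = ∑ k : Fin (n - 1) → ZMod p, ∑ z, ∑ z', h z * h z' *
          zmodCos (k ⬝ᵥ superdiag (z⁻¹ * z')) := by
        simp_rw [Finset.mul_sum]
        refine Eq.trans (Finset.sum_congr rfl fun z _ => ?_) Finset.sum_comm
        exact Finset.sum_comm
    _ = _ := by
        simp_rw [hsq]
        rw [← Fintype.prod_sum fun (_ : Fin (n - 1)) (κ : ZMod p) =>
          Real.exp (-(2 * (t / ((n : ℝ) - 1)) * charGap b κ)), Finset.prod_const,
          Finset.card_univ, Fintype.card_fin]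

attribute [local instance] Matrix.linftyOpNormedAddCommGroup Matrix.linftyOpNormedSpace
  Matrix.linftyOpNormedRing Matrix.linftyOpNormedAlgebra

/-- The coupon term is left abstract as ε because b = 1 and b ≥ 2 use different clock rates. -/
theorem tvDist_signedJumpDist_le (hn : 2 ≤ n) (b : ZMod p) {t : ℝ} (ht : 0 ≤ t) {ε : ℝ}
    (hε : ‖NormedSpace.exp (t • (walkMatrix (signedJumpDist n p b) - 1)) *
      (1 - walkMatrix (unifOn ((superdiagHom n p).ker : Set (unitUpper n p))))‖ ≤ 2 * ε) :
    tvDist (signedJumpDist n p b) t ≤ ε + (1 / 2) * Real.sqrt ((∑ κ : ZMod p,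
      Real.exp (-(2 * (t / ((n : ℝ) - 1)) * charGap b κ))) ^ (n - 1) - 1) := by
  refine (tvDist_le_norm_add_sqrt (signedJumpDist_isProbDist hn b) (superdiagHom n p).ker t).trans
    (add_le_add (by linarith) ?_)
  refine mul_le_mul_of_nonneg_left (Real.sqrt_le_sqrt ?_) (by norm_num)
  exact sub_le_sub_right (card_mul_sum_heatKernel_le hn b ht) 1

/-! ### Lower bound by the second moment method -/

/-- The uniform law is stationary, so an eigenfunction with eigenvalue different from 1 has mean
zero under it. -/
theorem sum_zmodCos_superdiag_eq_zero (hn : 2 ≤ n) (b : ZMod p) (k : Fin (n - 1) → ZMod p)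
    (hk : 0 < ∑ i, charGap b (k i)) :
    ∑ g : unitUpper n p, zmodCos (k ⬝ᵥ superdiag g) = 0 := by
  have hn' : (0 : ℝ) < (n : ℝ) - 1 := by
    have : (2 : ℝ) ≤ n := by exact_mod_cast hn
    linarith
  have h1 : ∑ x, (walkMatrix (signedJumpDist n p b) *ᵥ
      fun g => zmodCos (k ⬝ᵥ superdiag g)) x = ∑ g : unitUpper n p, zmodCos (k ⬝ᵥ superdiag g) := by
    change ∑ x, ∑ y, signedJumpDist n p b (x⁻¹ * y) * zmodCos (k ⬝ᵥ superdiag y) = _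
    rw [Finset.sum_comm]
    refine Finset.sum_congr rfl fun y _ => ?_
    rw [← Finset.sum_mul, show ∑ x, signedJumpDist n p b (x⁻¹ * y) =
      ∑ x, signedJumpDist n p b x from
        Fintype.sum_equiv ((Equiv.inv _).trans (Equiv.mulRight y)) _ _ fun x => rfl,
      (signedJumpDist_isProbDist hn b).sum_eq_one, one_mul]
  rw [walkMatrix_mulVec_zmodCos hn] at h1
  simp only [Pi.smul_apply, smul_eq_mul] at h1
  rw [← Finset.mul_sum] at h1
  have h2 : (∑ i, charGap b (k i)) / ((n : ℝ) - 1) ≠ 0 := (div_pos hk hn').ne'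
  have h3 : (∑ i, charGap b (k i)) / ((n : ℝ) - 1) *
      ∑ g : unitUpper n p, zmodCos (k ⬝ᵥ superdiag g) = 0 := by
    rw [walkEigenvalue] at h1
    linarith
  exact (mul_eq_zero.1 h3).resolve_left h2

theorem sum_charGap_single_add_single (b : ZMod p) {i j : Fin (n - 1)} (hij : i ≠ j) (κ κ' : ZMod p) :
    ∑ l, charGap b ((Pi.single i κ + Pi.single j κ' : Fin (n - 1) → ZMod p) l) =
      charGap b κ + charGap b κ' := by
  rw [← Finset.sum_subset (Finset.subset_univ {i, j}), Finset.sum_pair hij]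
  · simp [Pi.single_eq_of_ne hij, Pi.single_eq_of_ne hij.symm]
  · intro l _ hl
    simp only [Finset.mem_insert, Finset.mem_singleton, not_or] at hl
    simp [Pi.single_eq_of_ne hl.1, Pi.single_eq_of_ne hl.2]

theorem sum_charGap_single (b : ZMod p) (i : Fin (n - 1)) (κ : ZMod p) :
    ∑ l, charGap b ((Pi.single i κ : Fin (n - 1) → ZMod p) l) = charGap b κ := by
  rw [Finset.sum_eq_single i]
  · simp
  · intro l _ hl
    simp [Pi.single_eq_of_ne hl]
  · simp

/-- Turns pair correlations into characters supported on two coordinates, whose moments are known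
exactly. -/
theorem zmodCos_superdiag_mul (g : unitUpper n p) (i j : Fin (n - 1)) :
    zmodCos (superdiag g i) * zmodCos (superdiag g j) =
      (1 / 2) * (zmodCos ((Pi.single i 1 + Pi.single j 1) ⬝ᵥ superdiag g) +
        zmodCos ((Pi.single i 1 + Pi.single j (-1)) ⬝ᵥ superdiag g)) := by
  rw [zmodCos_mul_zmodCos]
  simp [add_dotProduct, sub_eq_add_neg]

/-- Second moments of the sum of the cosines of the superdiagonal entries, for a weight `h`. -/
theorem sum_mul_sq_sum_zmodCos_le (h : unitUpper n p → ℝ) (h0 : ∀ g, 0 ≤ h g)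
    (h1 : ∑ g, h g = 1) {m : ℝ} (hmean : ∀ i, ∑ g, h g * zmodCos (superdiag g i) = m)
    (hcorr : ∀ i j, i ≠ j → ∑ g, h g * (zmodCos (superdiag g i) * zmodCos (superdiag g j)) =
      m ^ 2) :
    ∑ g, h g * ((∑ i, zmodCos (superdiag g i)) - (n - 1 : ℕ) * m) ^ 2 ≤ (n - 1 : ℕ) := by
  set N : ℝ := ((n - 1 : ℕ) : ℝ) with hN
  have e : ∀ g, h g * ((∑ i, zmodCos (superdiag g i)) - N * m) ^ 2 =
      (∑ i, ∑ j, h g * (zmodCos (superdiag g i) * zmodCos (superdiag g j))) -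
        2 * N * m * ∑ i, h g * zmodCos (superdiag g i) + (N * m) ^ 2 * h g := by
    intro g
    rw [← Finset.mul_sum]
    simp_rw [← Finset.mul_sum]
    rw [← Finset.sum_mul]
    ring
  simp_rw [e]
  rw [Finset.sum_add_distrib, Finset.sum_sub_distrib, ← Finset.mul_sum, ← Finset.mul_sum, h1]
  have s1 : ∑ g, ∑ i : Fin (n - 1), h g * zmodCos (superdiag g i) = N * m := by
    rw [Finset.sum_comm]
    simp_rw [hmean]
    simp [hN]
  have s2 : ∑ g, ∑ i : Fin (n - 1), ∑ j : Fin (n - 1),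
      h g * (zmodCos (superdiag g i) * zmodCos (superdiag g j)) ≤ N ^ 2 * m ^ 2 + N := by
    have hle : ∀ i j : Fin (n - 1),
        ∑ g, h g * (zmodCos (superdiag g i) * zmodCos (superdiag g j)) ≤
          m ^ 2 + if i = j then 1 else 0 := by
      intro i j
      by_cases hij : i = j
      · subst hij
        rw [if_pos rfl]
        have : ∑ g, h g * (zmodCos (superdiag g i) * zmodCos (superdiag g i)) ≤ ∑ g, h g := by
          refine Finset.sum_le_sum fun g _ => mul_le_of_le_one_right (h0 g) ?_
          rw [← sq]
          exact zmodCos_sq_le_one _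
        rw [h1] at this
        nlinarith [sq_nonneg m]
      · rw [if_neg hij, add_zero, hcorr i j hij]
    calc _ = ∑ i : Fin (n - 1), ∑ j : Fin (n - 1),
          ∑ g, h g * (zmodCos (superdiag g i) * zmodCos (superdiag g j)) := by
          rw [Finset.sum_comm]
          exact Finset.sum_congr rfl fun i _ => Finset.sum_comm
      _ ≤ ∑ i : Fin (n - 1), ∑ j : Fin (n - 1), (m ^ 2 + if i = j then (1 : ℝ) else 0) :=
          Finset.sum_le_sum fun i _ => Finset.sum_le_sum fun j _ => hle i j
      _ = _ := by
          simp only [Finset.sum_add_distrib, Finset.sum_const, Finset.card_univ, Fintype.card_fin,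
            nsmul_eq_mul, Finset.sum_ite_eq, Finset.mem_univ, if_true, ← hN]
          ring
  rw [s1]
  nlinarith

/-- The statistic f has mean M = (n-1)m under the walk and 0 under the uniform law. Distinct
coordinates are uncorrelated in both cases, so the variances are at most n - 1. Chebyshev's
inequality at the threshold M/2 costs 4(n-1)/M² for each law, which gives the 8. -/
theorem le_tvDist_signedJumpDist (hn : 2 ≤ n) (b : ZMod p) (hb : 0 < charGap b 1) {t : ℝ}
    (ht : 0 ≤ t) :
    1 - 8 / (((n : ℝ) - 1) * Real.exp (-(2 * (t / ((n : ℝ) - 1)) * charGap b 1))) ≤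
      tvDist (signedJumpDist n p b) t := by
  have hn' : (0 : ℝ) < (n : ℝ) - 1 := by
    have : (2 : ℝ) ≤ n := by exact_mod_cast hn
    linarith
  have hN : ((n - 1 : ℕ) : ℝ) = (n : ℝ) - 1 := by
    rw [Nat.cast_sub (by omega), Nat.cast_one]
  set m := Real.exp (-(t / ((n : ℝ) - 1) * charGap b 1)) with hm
  have hm0 : 0 < m := Real.exp_pos _
  have hm2 : Real.exp (-(2 * (t / ((n : ℝ) - 1)) * charGap b 1)) = m ^ 2 := by
    rw [hm, sq, ← Real.exp_add]
    ring_nf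
  rw [hm2]
  set f : unitUpper n p → ℝ := fun g => ∑ i, zmodCos (superdiag g i) with hf
  set M := ((n : ℝ) - 1) * m with hM
  have hMpos : 0 < M := by positivity
  have hprob := signedJumpDist_isProbDist (n := n) hn b
  set h := heatKernel (signedJumpDist n p b) t 1 with hh
  have h0 : ∀ z, 0 ≤ h z := fun z => heatKernel_nonneg hprob ht 1 z
  have h1 : ∑ g, h g = 1 := sum_heatKernel hprob t 1
  have hvar : ∑ g, h g * (f g - M) ^ 2 ≤ (n : ℝ) - 1 := by
    have := sum_mul_sq_sum_zmodCos_le h h0 h1 (m := m) (fun i => by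
      have := sum_heatKernel_mul_zmodCos hn b (Pi.single i 1 : Fin (n - 1) → ZMod p) t
      rw [sum_charGap_single] at this
      simpa using this) (fun i j hij => by
      simp_rw [zmodCos_superdiag_mul, mul_left_comm (h _), mul_add]
      rw [Finset.sum_add_distrib, ← Finset.mul_sum, ← Finset.mul_sum, hh,
        sum_heatKernel_mul_zmodCos hn, sum_heatKernel_mul_zmodCos hn,
        sum_charGap_single_add_single b hij, sum_charGap_single_add_single b hij, charGap_neg,
        ← hm2]
      ring_nf)
    rwa [hN] at this
  set u : ℝ := 1 / (Fintype.card (unitUpper n p) : ℝ) with hu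
  have hu0 : 0 < u := by positivity
  have huvar : ∑ g, u * f g ^ 2 ≤ (n : ℝ) - 1 := by
    have := sum_mul_sq_sum_zmodCos_le (fun _ : unitUpper n p => u) (fun _ => hu0.le)
      (by simp [hu]) (m := 0) (fun i => by
        have := sum_zmodCos_superdiag_eq_zero hn b (Pi.single i 1 : Fin (n - 1) → ZMod p)
          (by rwa [sum_charGap_single])
        rw [← Finset.mul_sum]
        simp only [single_dotProduct, one_mul] at this
        rw [this, mul_zero]) (fun i j hij => by
        simp_rw [zmodCos_superdiag_mul]
        rw [← Finset.mul_sum, ← Finset.mul_sum, Finset.sum_add_distrib,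
          sum_zmodCos_superdiag_eq_zero hn b, sum_zmodCos_superdiag_eq_zero hn b]
        · ring
        · rw [sum_charGap_single_add_single b hij, charGap_neg]
          linarith
        · rw [sum_charGap_single_add_single b hij]
          linarith)
    simpa only [hN, mul_zero, sub_zero] using this
  set S : Finset (unitUpper n p) := Finset.univ.filter fun g => M / 2 ≤ f g with hS
  have hSc : ∑ g ∈ Sᶜ, h g ≤ 4 * ((n : ℝ) - 1) / M ^ 2 := by
    rw [le_div_iff₀ (by positivity)]
    calc (∑ g ∈ Sᶜ, h g) * M ^ 2 = ∑ g ∈ Sᶜ, h g * M ^ 2 := Finset.sum_mul _ _ _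
      _ ≤ ∑ g ∈ Sᶜ, 4 * (h g * (f g - M) ^ 2) := by
        refine Finset.sum_le_sum fun g hg => ?_
        simp only [hS, Finset.mem_compl, Finset.mem_filter, Finset.mem_univ, true_and, not_le]
          at hg
        have : M ^ 2 ≤ 4 * (f g - M) ^ 2 := by nlinarith
        nlinarith [mul_le_mul_of_nonneg_left this (h0 g)]
      _ ≤ ∑ g, 4 * (h g * (f g - M) ^ 2) :=
        Finset.sum_le_sum_of_subset_of_nonneg (Finset.subset_univ _) fun g _ _ => by
          have := h0 g
          positivity
      _ ≤ 4 * ((n : ℝ) - 1) := by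
        rw [← Finset.mul_sum]
        linarith
  have hSu : (S.card : ℝ) / Fintype.card (unitUpper n p) ≤ 4 * ((n : ℝ) - 1) / M ^ 2 := by
    rw [le_div_iff₀ (by positivity)]
    calc (S.card : ℝ) / Fintype.card (unitUpper n p) * M ^ 2 = ∑ g ∈ S, u * M ^ 2 := by
          rw [Finset.sum_const, nsmul_eq_mul, hu]
          ring
      _ ≤ ∑ g ∈ S, 4 * (u * f g ^ 2) := by
        refine Finset.sum_le_sum fun g hg => ?_
        have hg' : M / 2 ≤ f g := (Finset.mem_filter.1 hg).2
        have : M ^ 2 ≤ 4 * f g ^ 2 := by nlinarith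
        nlinarith [mul_le_mul_of_nonneg_left this hu0.le]
      _ ≤ ∑ g, 4 * (u * f g ^ 2) :=
        Finset.sum_le_sum_of_subset_of_nonneg (Finset.subset_univ _) fun g _ _ => by positivity
      _ ≤ 4 * ((n : ℝ) - 1) := by
        rw [← Finset.mul_sum]
        linarith
  have hfin := one_sub_sub_le_tvDist hprob t S
  have e8 : 8 / (((n : ℝ) - 1) * m ^ 2) = 4 * ((n : ℝ) - 1) / M ^ 2 + 4 * ((n : ℝ) - 1) / M ^ 2 := by
    rw [hM]
    field_simp
    norm_num
  rw [e8]
  linarith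

end Fourier

/-! ### Growth of the character gap, uniformly in p -/

section SpectralGap

/-- Conditions on the modulus `p` and the jump size `b` under which `1` is the slowest character. -/
def AdmissibleJump (p b : ℕ) : Prop :=
  6 ≤ p ∧ (b = 1 ∨ (2 ≤ b ∧ 16 ≤ p ∧ (b ^ 2 - 1) ^ 2 ≤ p))

theorem admissibleJump_one {p : ℕ} (hp : 6 ≤ p) : AdmissibleJump p 1 := ⟨hp, Or.inl rfl⟩

/-- The construction gives b² ≤ a ≤ ⌊√p⌋ + 1, hence (b² - 1)² ≤ p. -/
theorem admissibleJump_jumpSize {p : ℕ} (hp : 6 ≤ p) : AdmissibleJump p (jumpSize p) := by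
  refine ⟨hp, ?_⟩
  have ha : jumpSize p * jumpSize p ≤ oddSqrt p := Nat.sqrt_le _
  have ha' : oddSqrt p ≤ Nat.sqrt p + 1 := by
    unfold oddSqrt
    split_ifs <;> omega
  have hs : Nat.sqrt p * Nat.sqrt p ≤ p := Nat.sqrt_le p
  have hs2 : 2 ≤ Nat.sqrt p := Nat.le_sqrt.2 (by omega)
  have hb : 1 ≤ jumpSize p := by
    refine Nat.le_sqrt.2 ?_
    unfold oddSqrt
    omega
  rcases hb.eq_or_lt with h | h
  · exact Or.inl h.symm
  · refine Or.inr ⟨h, ?_, ?_⟩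
    · have h4 : 4 ≤ oddSqrt p := by nlinarith
      have h5 : 4 ≤ Nat.sqrt p := by
        -- A value b ≥ 2 needs a ≥ 4, but ⌊√p⌋ = 3 is odd and gives a = 3. This forces ⌊√p⌋ ≥ 4,
        -- that is p ≥ 16.
        by_contra hlt
        have h3 : Nat.sqrt p = 3 := by omega
        have : oddSqrt p = 3 := by
          unfold oddSqrt
          rw [h3, if_neg (by decide)]
        omega
      nlinarith
    · have : jumpSize p ^ 2 - 1 ≤ Nat.sqrt p := by
        rw [sq]
        omega
      calc (jumpSize p ^ 2 - 1) ^ 2 ≤ Nat.sqrt p ^ 2 := Nat.pow_le_pow_left this 2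
        _ ≤ p := by rw [sq]; exact hs

theorem two_mul_mul_le_of_admissible {p b : ℕ} (hb : 3 ≤ b) (h : (b ^ 2 - 1) ^ 2 ≤ p) :
    2 * b * (1 + b ^ 2) ≤ p ∧ 64 ≤ p := by
  have h9 : 9 ≤ b ^ 2 := by nlinarith
  obtain ⟨c, hc⟩ : ∃ c, b ^ 2 = c + 1 := ⟨b ^ 2 - 1, by omega⟩
  rw [hc] at h
  simp only [Nat.add_sub_cancel] at h
  have hc8 : 8 ≤ c := by omega
  refine ⟨le_trans ?_ h, by nlinarith⟩
  have h3 : 3 * b ≤ c + 1 := by nlinarith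
  rw [hc]
  nlinarith

/-- Jordan's inequality gives sin²(kx) ≥ 4k²x²/π², which for k ≥ 2 exceeds the linear factor with
much room since π² ≤ 10. Linear growth in k is all that a geometric series needs. -/
theorem sin_sq_mul_ge {x : ℝ} (hx : 0 ≤ x) {k : ℕ} (hk : 1 ≤ k) (hkx : k * x ≤ Real.pi / 2) :
    Real.sin x ^ 2 * (1 + ((k : ℝ) - 1) / 20) ≤ Real.sin (k * x) ^ 2 := by
  rcases hk.eq_or_lt with h | h
  · subst h
    simp
  · have hk2 : (2 : ℝ) ≤ k := by exact_mod_cast h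
    have hkx0 : 0 ≤ (k : ℝ) * x := by positivity
    have h1 : 2 / Real.pi * (k * x) ≤ Real.sin (k * x) := Real.mul_le_sin hkx0 hkx
    have hpi : Real.pi ^ 2 ≤ 10 := by nlinarith [Real.pi_lt_d2, Real.pi_pos]
    have h2 : Real.sin x ^ 2 ≤ x ^ 2 := Real.sin_sq_le_sq
    have h3 : (2 / Real.pi * (k * x)) ^ 2 ≤ Real.sin (k * x) ^ 2 := by
      have : 0 ≤ 2 / Real.pi * (k * x) := by have := Real.pi_pos; positivity
      gcongr
    have h4 : x ^ 2 * (1 + ((k : ℝ) - 1) / 20) ≤ (2 / Real.pi * (k * x)) ^ 2 := by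
      have e : (2 / Real.pi * (k * x)) ^ 2 = x ^ 2 * (4 * (k : ℝ) ^ 2 / Real.pi ^ 2) := by
        ring
      rw [e]
      refine mul_le_mul_of_nonneg_left ?_ (sq_nonneg x)
      rw [le_div_iff₀ (by have := Real.pi_pos; positivity)]
      have : (1 + ((k : ℝ) - 1) / 20) * Real.pi ^ 2 ≤ (1 + ((k : ℝ) - 1) / 20) * 10 :=
        mul_le_mul_of_nonneg_left hpi (by linarith)
      nlinarith
    have h5 : Real.sin x ^ 2 * (1 + ((k : ℝ) - 1) / 20) ≤ x ^ 2 * (1 + ((k : ℝ) - 1) / 20) :=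
      mul_le_mul_of_nonneg_right h2 (by linarith)
    linarith

variable {p b : ℕ} [NeZero p]

theorem charGap_natCast (b k : ℕ) : charGap (b : ZMod p) (k : ZMod p) =
    Real.sin (k * (Real.pi / p)) ^ 2 + Real.sin (k * (b * (Real.pi / p))) ^ 2 := by
  rw [charGap, ← Nat.cast_mul, zmodCos_natCast, zmodCos_natCast]
  have e1 : 2 * Real.pi * k / p = 2 * (k * (Real.pi / p)) := by ring
  have e2 : 2 * Real.pi * (b * k : ℕ) / p = 2 * (k * (b * (Real.pi / p))) := by
    push_cast
    ring
  rw [e1, e2, Real.cos_two_mul, Real.cos_two_mul]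
  have h1 := Real.sin_sq_add_cos_sq (k * (Real.pi / p))
  have h2 := Real.sin_sq_add_cos_sq (k * (b * (Real.pi / p)))
  linarith

theorem charGap_one (b : ℕ) : charGap (b : ZMod p) 1 =
    Real.sin (Real.pi / p) ^ 2 + Real.sin (b * (Real.pi / p)) ^ 2 := by
  have h := charGap_natCast (p := p) b 1
  simpa using h

theorem two_mul_charGap_one (b : ℕ) : 2 * charGap (b : ZMod p) 1 =
    (1 - Real.cos (2 * Real.pi / p)) + (1 - Real.cos (2 * Real.pi * b / p)) := by
  have h1 := zmodCos_natCast (p := p) 1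
  have h2 := zmodCos_natCast (p := p) b
  rw [Nat.cast_one, Nat.cast_one, mul_one] at h1
  rw [charGap, mul_one, h1, h2]
  ring

theorem charGap_one_le (b : ℕ) :
    charGap (b : ZMod p) 1 * (p : ℝ) ^ 2 ≤ 10 * (1 + (b : ℝ) ^ 2) := by
  have hp : (p : ℝ) ≠ 0 := by exact_mod_cast NeZero.ne p
  have hpi : Real.pi ^ 2 ≤ 10 := by nlinarith [Real.pi_lt_d2, Real.pi_pos]
  have h1 : Real.sin (Real.pi / p) ^ 2 ≤ (Real.pi / p) ^ 2 := Real.sin_sq_le_sq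
  have h2 : Real.sin (b * (Real.pi / p)) ^ 2 ≤ (b * (Real.pi / p)) ^ 2 := Real.sin_sq_le_sq
  rw [charGap_one]
  calc _ ≤ ((Real.pi / p) ^ 2 + (b * (Real.pi / p)) ^ 2) * (p : ℝ) ^ 2 := by gcongr
    _ = Real.pi ^ 2 * (1 + (b : ℝ) ^ 2) := by
      field_simp
    _ ≤ _ := by gcongr

theorem charGap_one_pos (hpb : AdmissibleJump p b) : 0 < charGap (b : ZMod p) 1 := by
  rw [charGap_one]
  have hp : (6 : ℝ) ≤ p := by exact_mod_cast hpb.1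
  have : 0 < Real.sin (Real.pi / p) := by
    refine Real.sin_pos_of_pos_of_lt_pi (by have := Real.pi_pos; positivity) ?_
    rw [div_lt_iff₀ (by linarith)]
    nlinarith [Real.pi_pos]
  positivity

/-- Here p ≥ 6 enters, through sin(π/6) = 1/2. The bound places the coupon-collector time
(n-1)log(n-1) no later than the cutoff time. -/
theorem charGap_one_le_half (hp : 6 ≤ p) : charGap ((1 : ℕ) : ZMod p) 1 ≤ 1 / 2 := by
  rw [charGap_one, Nat.cast_one, one_mul]
  have hp' : (6 : ℝ) ≤ p := by exact_mod_cast hp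
  have h0 : 0 ≤ Real.pi / p := by have := Real.pi_pos; positivity
  have h1 : Real.pi / p ≤ Real.pi / 6 := by
    have := Real.pi_pos
    gcongr
  have h2 : Real.sin (Real.pi / p) ≤ 1 / 2 := by
    rw [← Real.sin_pi_div_six]
    exact Real.sin_le_sin_of_le_of_le_pi_div_two (by linarith [Real.pi_pos])
      (by linarith [Real.pi_pos]) h1
  have h3 : 0 ≤ Real.sin (Real.pi / p) := Real.sin_nonneg_of_nonneg_of_le_pi h0
    (by linarith [Real.pi_pos])
  nlinarith

/-- When only half of the jumps count as coupons, collection takes twice as long, so the gap must be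
half as large. -/
theorem charGap_one_le_quarter (hb : 2 ≤ b) (hp : 16 ≤ p) (h : (b ^ 2 - 1) ^ 2 ≤ p) :
    charGap (b : ZMod p) 1 ≤ 1 / 4 := by
  have h1 := charGap_one_le (p := p) b
  have hp' : (16 : ℝ) ≤ p := by exact_mod_cast hp
  have h2 : 40 * (1 + (b : ℝ) ^ 2) ≤ (p : ℝ) ^ 2 := by
    rcases hb.eq_or_lt with h2 | h2
    · subst h2
      push_cast
      nlinarith
    · obtain ⟨h3, h4⟩ := two_mul_mul_le_of_admissible h2 h
      have h3' : 2 * (b : ℝ) * (1 + (b : ℝ) ^ 2) ≤ p := by exact_mod_cast h3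
      have h4' : (64 : ℝ) ≤ p := by exact_mod_cast h4
      have h5 : (3 : ℝ) ≤ b := by exact_mod_cast h2
      have h6 : 6 * (1 + (b : ℝ) ^ 2) ≤ p := by nlinarith [sq_nonneg (b : ℝ)]
      nlinarith
  have h3 : (0 : ℝ) < (p : ℝ) ^ 2 := by positivity
  have h4 : charGap (b : ZMod p) 1 * (p : ℝ) ^ 2 ≤ 1 / 4 * (p : ℝ) ^ 2 := by linarith
  exact le_of_mul_le_mul_right h4 h3

/-- If kb ≤ p/2, both sine terms grow by the same comparison. Otherwise the angle for b may have
wrapped around, but then k > p/(2b) is so large that the term of the jumps ±1 alone dominates. -/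
theorem charGap_ge (hpb : AdmissibleJump p b) {k : ℕ} (hk : 1 ≤ k) (hkp : 2 * k ≤ p) :
    charGap (b : ZMod p) 1 * (1 + ((k : ℝ) - 1) / 20) ≤ charGap (b : ZMod p) (k : ZMod p) := by
  have hp0 : (0 : ℝ) < p := by exact_mod_cast NeZero.pos p
  have hx : 0 ≤ Real.pi / p := by have := Real.pi_pos; positivity
  have hkp' : 2 * (k : ℝ) ≤ p := by exact_mod_cast hkp
  have hkx : (k : ℝ) * (Real.pi / p) ≤ Real.pi / 2 := by
    rw [mul_div_assoc', div_le_div_iff₀ hp0 two_pos]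
    nlinarith [Real.pi_pos]
  by_cases hbk : 2 * (k * b) ≤ p
  · rw [charGap_natCast, charGap_one, add_mul]
    have hbk' : 2 * ((k : ℝ) * b) ≤ p := by exact_mod_cast hbk
    refine add_le_add (sin_sq_mul_ge hx hk hkx) (sin_sq_mul_ge (by positivity) hk ?_)
    rw [← mul_assoc, mul_div_assoc', div_le_div_iff₀ hp0 two_pos]
    nlinarith [Real.pi_pos]
  · have h1 := charGap_one_le (p := p) b
    obtain ⟨hb, hp16, hbp⟩ := hpb.2.resolve_left (by rintro rfl; omega)
    -- This is 10(1 + b²)(1 + (k-1)/20) ≤ 4k² after clearing denominators: the left side bounds p²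
    -- times the scaled gap at 1, and the right side comes from Jordan's inequality.
    have hkey : (1 + b ^ 2) * (19 + k) ≤ 8 * k ^ 2 := by
      rcases hb.eq_or_lt with h2 | h2
      · subst h2
        have : 5 ≤ k := by omega
        nlinarith
      · obtain ⟨h3, h4⟩ := two_mul_mul_le_of_admissible h2 hbp
        have h5 : 1 + b ^ 2 ≤ k := by
          by_contra hlt
          push Not at hlt
          have : 2 * b * k ≤ 2 * b * (1 + b ^ 2) := Nat.mul_le_mul_left _ hlt.le
          nlinarith
        nlinarith
    have hkey' : (1 + (b : ℝ) ^ 2) * (19 + k) ≤ 8 * (k : ℝ) ^ 2 := by exact_mod_cast hkey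
    have hk' : (1 : ℝ) ≤ k := by exact_mod_cast hk
    have h2 : 2 * (k : ℝ) / p ≤ Real.sin (k * (Real.pi / p)) := by
      have h3 := Real.mul_le_sin (by positivity) hkx
      have e : 2 / Real.pi * (k * (Real.pi / p)) = 2 * (k : ℝ) / p := by
        field_simp
      rwa [e] at h3
    have h3 : (2 * (k : ℝ) / p) ^ 2 ≤ charGap (b : ZMod p) (k : ZMod p) := by
      rw [charGap_natCast]
      have : (2 * (k : ℝ) / p) ^ 2 ≤ Real.sin (k * (Real.pi / p)) ^ 2 := by gcongr
      nlinarith [sq_nonneg (Real.sin (k * (b * (Real.pi / p))))]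
    refine le_trans ?_ h3
    rw [div_pow, le_div_iff₀ (by positivity)]
    have h4 : charGap (b : ZMod p) 1 * (p : ℝ) ^ 2 * (1 + ((k : ℝ) - 1) / 20) ≤
        10 * (1 + (b : ℝ) ^ 2) * (1 + ((k : ℝ) - 1) / 20) :=
      mul_le_mul_of_nonneg_right h1 (by linarith)
    nlinarith

/-- Since κ and -κ have the same gap, both halves of ℤ/p are bounded by the same geometric series.
The hypothesis keeps its ratio below e^{-1/20}, so the constant does not depend on p. -/
theorem sum_exp_charGap_le (hpb : AdmissibleJump p b) {s : ℝ} (hs : 1 ≤ s * charGap (b : ZMod p) 1) :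
    ∑ κ : ZMod p, Real.exp (-(s * charGap (b : ZMod p) κ)) ≤
      1 + 2 / (1 - Real.exp (-(1 / 20))) * Real.exp (-(s * charGap (b : ZMod p) 1)) := by
  set τ := s * charGap (b : ZMod p) 1 with hτ
  have hL := charGap_one_pos hpb
  have hs0 : 0 ≤ s := by
    by_contra h
    push Not at h
    nlinarith
  set r := Real.exp (-(τ / 20)) with hr
  set F : ℕ → ℝ := fun k => Real.exp (-(s * charGap (b : ZMod p) (k : ZMod p))) with hF
  have h1 : ∑ κ : ZMod p, Real.exp (-(s * charGap (b : ZMod p) κ)) =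
      ∑ k ∈ Finset.range p, F k := by
    refine Finset.sum_nbij' ZMod.val (fun k => (k : ZMod p)) ?_ ?_ ?_ ?_ ?_
    · intro κ _
      exact Finset.mem_range.2 (ZMod.val_lt κ)
    · intro k _
      exact Finset.mem_univ _
    · intro κ _
      exact ZMod.natCast_zmod_val κ
    · intro k hk
      exact ZMod.val_cast_of_lt (Finset.mem_range.1 hk)
    · intro κ _
      simp [hF]
  have hE : ∀ j : ℕ, Real.exp (-(τ * (1 + (j : ℝ) / 20))) = Real.exp (-τ) * r ^ j := fun j => by
    rw [hr, ← Real.exp_nat_mul, ← Real.exp_add]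
    congr 1
    ring
  have hF1 : ∀ k : ℕ, 1 ≤ k → 2 * k ≤ p → F k ≤ Real.exp (-τ) * r ^ (k - 1) := by
    intro k hk hkp
    rw [← hE, hF]
    simp only
    rw [Real.exp_le_exp, neg_le_neg_iff, hτ, mul_assoc, Nat.cast_sub hk, Nat.cast_one]
    exact mul_le_mul_of_nonneg_left (charGap_ge hpb hk hkp) hs0
  have hr0 : 0 < r := Real.exp_pos _
  -- Bounding each term by the sum of the series read from both ends avoids splitting the range by
  -- the parity of p.
  have hF2 : ∀ j ∈ Finset.range (p - 1), F (j + 1) ≤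
      Real.exp (-τ) * r ^ j + Real.exp (-τ) * r ^ (p - 1 - 1 - j) := by
    intro j hj
    rw [Finset.mem_range] at hj
    have p1 : 0 ≤ Real.exp (-τ) * r ^ j := by positivity
    have p2 : 0 ≤ Real.exp (-τ) * r ^ (p - 1 - 1 - j) := by positivity
    by_cases h : 2 * (j + 1) ≤ p
    · have := hF1 (j + 1) (by omega) h
      rw [Nat.add_sub_cancel] at this
      linarith
    · have h3 := hF1 (p - (j + 1)) (by omega) (by omega)
      have e : F (p - (j + 1)) = F (j + 1) := by
        simp only [hF]
        rw [Nat.cast_sub (by omega), ZMod.natCast_self, zero_sub, charGap_neg]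
      rw [e, show p - (j + 1) - 1 = p - 1 - 1 - j by omega] at h3
      linarith
  have hr1 : r ≤ Real.exp (-(1 / 20)) := by
    rw [hr, Real.exp_le_exp]
    linarith
  have hr2 : Real.exp (-(1 / 20 : ℝ)) < 1 := by
    rw [Real.exp_lt_one_iff]
    norm_num
  have hgeom : ∑ j ∈ Finset.range (p - 1), r ^ j ≤ 1 / (1 - Real.exp (-(1 / 20))) := by
    have hsum := (summable_geometric_of_lt_one hr0.le (hr1.trans_lt hr2)).sum_le_tsum
      (Finset.range (p - 1)) fun j _ => by positivity
    rw [tsum_geometric_of_lt_one hr0.le (hr1.trans_lt hr2)] at hsum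
    refine hsum.trans ?_
    rw [← one_div]
    exact one_div_le_one_div_of_le (by linarith) (by linarith)
  have hp1 : p = (p - 1) + 1 := by have := hpb.1; omega
  rw [h1, hp1, Finset.sum_range_succ']
  have hF0 : F 0 = 1 := by simp [hF]
  rw [hF0]
  have h2 := Finset.sum_le_sum hF2
  rw [Finset.sum_add_distrib, ← Finset.mul_sum, ← Finset.mul_sum,
    Finset.sum_range_reflect (fun j => r ^ j)] at h2
  have h3 := mul_le_mul_of_nonneg_left hgeom (Real.exp_pos (-τ)).le
  have e : 2 / (1 - Real.exp (-(1 / 20))) * Real.exp (-τ) =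
      2 * (Real.exp (-τ) * (1 / (1 - Real.exp (-(1 / 20))))) := by ring
  rw [e]
  linarith

end SpectralGap

/-! ### Cutoff from explicit bounds -/

section Cutoff

attribute [local instance] Matrix.linftyOpNormedAddCommGroup Matrix.linftyOpNormedSpace
  Matrix.linftyOpNormedRing Matrix.linftyOpNormedAlgebra

/-- The bounds are two-sided because liminf and limsup over ℝ are controlled only for bounded
sequences. For fixed c they are needed only for large n. -/
theorem exhibitsCutoff_of_bounds {d : ℕ → ℝ → ℝ} {t w : ℕ → ℝ} {lo up : ℝ → ℝ}
    (hw : ∀ n, 0 < w n) (hwt : w =o[atTop] t) (hlo : Tendsto lo atTop (𝓝 1))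
    (hup : Tendsto up atTop (𝓝 0))
    (h1 : ∀ᶠ c in atTop, ∀ᶠ n in atTop, lo c ≤ d n (t n - c * w n) ∧ d n (t n - c * w n) ≤ 1)
    (h2 : ∀ᶠ c in atTop, ∀ᶠ n in atTop, 0 ≤ d n (t n + c * w n) ∧ d n (t n + c * w n) ≤ up c) :
    ExhibitsCutoff d t := by
  refine ⟨w, hw, hwt, ?_, ?_⟩
  · refine tendsto_of_tendsto_of_tendsto_of_le_of_le' hlo tendsto_const_nhds ?_ ?_
    · filter_upwards [h1] with c hc
      exact le_liminf_of_le
        (IsBoundedUnder.isCoboundedUnder_ge ⟨1, eventually_map.2 (hc.mono fun n h => h.2)⟩)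
        (hc.mono fun n h => h.1)
    · filter_upwards [h1] with c hc
      refine liminf_le_of_frequently_le (hc.mono fun n h => h.2).frequently
        ⟨lo c, eventually_map.2 (hc.mono fun n h => h.1)⟩
  · refine tendsto_of_tendsto_of_tendsto_of_le_of_le' tendsto_const_nhds hup ?_ ?_
    · filter_upwards [h2] with c hc
      refine le_limsup_of_frequently_le (hc.mono fun n h => h.1).frequently
        ⟨up c, eventually_map.2 (hc.mono fun n h => h.2)⟩
    · filter_upwards [h2] with c hc
      exact limsup_le_of_le
        (IsBoundedUnder.isCoboundedUnder_le ⟨0, eventually_map.2 (hc.mono fun n h => h.1)⟩)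
        (hc.mono fun n h => h.2)

/-- Upper bound on the distance at `c` windows after the cutoff time. -/
theorem tvDist_signedJumpDist_le_of_admissible {n p b : ℕ} [NeZero p] (hn : 2 ≤ n)
    (hpb : AdmissibleJump p b) {c : ℝ} (hc : 1 ≤ c) :
    tvDist (signedJumpDist n p (b : ZMod p))
      (((n : ℝ) - 1) * Real.log ((n : ℝ) - 1) / (2 * charGap (b : ZMod p) 1) +
        c * (((n : ℝ) - 1) / charGap (b : ZMod p) 1)) ≤
      Real.exp (-(2 * c)) + (1 / 2) * Real.sqrt (Real.exp (2 / (1 - Real.exp (-(1 / 20))) *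
        Real.exp (-(2 * c))) - 1) := by
  have hn1 : (1 : ℝ) ≤ (n : ℝ) - 1 := by
    have : (2 : ℝ) ≤ n := by exact_mod_cast hn
    linarith
  have hn' : (0 : ℝ) < (n : ℝ) - 1 := by linarith
  have hL := charGap_one_pos hpb
  set L := charGap (b : ZMod p) 1 with hLd
  set ℓ := Real.log ((n : ℝ) - 1) with hℓ
  have hℓ0 : 0 ≤ ℓ := Real.log_nonneg hn1
  set T := ((n : ℝ) - 1) * ℓ / (2 * L) + c * (((n : ℝ) - 1) / L) with hT
  have hT0 : 0 ≤ T := by positivity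
  have hTn : T / ((n : ℝ) - 1) = (ℓ + 2 * c) / (2 * L) := by
    rw [hT]
    field_simp
  have hexp : ((n : ℝ) - 1) * Real.exp (-(ℓ + 2 * c)) = Real.exp (-(2 * c)) := by
    rw [neg_add, Real.exp_add, hℓ, Real.exp_neg (Real.log _), Real.exp_log hn', ← mul_assoc,
      mul_inv_cancel₀ hn'.ne', one_mul]
  have hcoupon : ‖NormedSpace.exp (T • (walkMatrix (signedJumpDist n p (b : ZMod p)) - 1)) *
      (1 - walkMatrix (unifOn ((superdiagHom n p).ker : Set (unitUpper n p))))‖ ≤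
      2 * Real.exp (-(2 * c)) := by
    -- For b = 1 the clocks of the classes C_i(±1) run at full rate and L ≤ 1/2 suffices; for b ≥ 2
    -- they run at half rate and L ≤ 1/4 compensates.
    rcases hpb.2 with hb | ⟨hb, hp, hbp⟩
    · subst hb
      have h1 : L ≤ 1 / 2 := charGap_one_le_half hpb.1
      rw [Nat.cast_one]
      refine (norm_exp_signedJumpDist_one_mul_le hn hT0).trans ?_
      rw [← hexp, hTn]
      gcongr
      rw [le_div_iff₀ (by positivity)]
      nlinarith
    · have h1 : L ≤ 1 / 4 := charGap_one_le_quarter hb hp hbp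
      refine (norm_exp_signedJumpDist_mul_le hn _ hT0).trans ?_
      have e : T / (2 * ((n : ℝ) - 1)) = (ℓ + 2 * c) / (2 * L) / 2 := by
        rw [← hTn]
        field_simp
      rw [← hexp, e, div_div]
      gcongr
      rw [le_div_iff₀ (by positivity)]
      nlinarith
  refine (tvDist_signedJumpDist_le hn _ hT0 hcoupon).trans (add_le_add le_rfl ?_)
  refine mul_le_mul_of_nonneg_left (Real.sqrt_le_sqrt (sub_le_sub_right ?_ 1)) (by norm_num)
  set C := 2 / (1 - Real.exp (-(1 / 20))) with hC
  have hC0 : 0 ≤ C := by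
    have : Real.exp (-(1 / 20 : ℝ)) < 1 := by
      rw [Real.exp_lt_one_iff]
      norm_num
    exact div_nonneg two_pos.le (by linarith)
  have hτ : 2 * (T / ((n : ℝ) - 1)) * L = ℓ + 2 * c := by
    rw [hTn]
    field_simp
  have hsum := sum_exp_charGap_le hpb (s := 2 * (T / ((n : ℝ) - 1))) (by rw [← hLd, hτ]; linarith)
  rw [← hLd, hτ] at hsum
  -- By 1 + x ≤ e^x, the (n-1)-st power cancels the factor 1/(n-1) contained in e^{-ℓ}, leaving a
  -- bound in c alone.
  have h1 : 1 + C * Real.exp (-(ℓ + 2 * c)) ≤ Real.exp (C * Real.exp (-(ℓ + 2 * c))) := by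
    have := Real.add_one_le_exp (C * Real.exp (-(ℓ + 2 * c)))
    linarith
  calc _ ≤ (Real.exp (C * Real.exp (-(ℓ + 2 * c)))) ^ (n - 1) :=
        pow_le_pow_left₀ (Finset.sum_nonneg fun κ _ => (Real.exp_pos _).le) (hsum.trans h1) _
    _ = Real.exp (C * Real.exp (-(2 * c))) := by
        rw [← Real.exp_nat_mul, ← hexp, Nat.cast_sub (by omega), Nat.cast_one]
        congr 1
        ring

/-- Lower bound on the distance at `c` windows before the cutoff time. -/
theorem le_tvDist_signedJumpDist_of_admissible {n p b : ℕ} [NeZero p] (hn : 2 ≤ n)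
    (hpb : AdmissibleJump p b) {c : ℝ} (hc : 2 * c ≤ Real.log ((n : ℝ) - 1)) :
    1 - 8 * Real.exp (-(2 * c)) ≤ tvDist (signedJumpDist n p (b : ZMod p))
      (((n : ℝ) - 1) * Real.log ((n : ℝ) - 1) / (2 * charGap (b : ZMod p) 1) -
        c * (((n : ℝ) - 1) / charGap (b : ZMod p) 1)) ∧
    tvDist (signedJumpDist n p (b : ZMod p))
      (((n : ℝ) - 1) * Real.log ((n : ℝ) - 1) / (2 * charGap (b : ZMod p) 1) -
        c * (((n : ℝ) - 1) / charGap (b : ZMod p) 1)) ≤ 1 := by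
  have hn1 : (1 : ℝ) ≤ (n : ℝ) - 1 := by
    have : (2 : ℝ) ≤ n := by exact_mod_cast hn
    linarith
  have hn' : (0 : ℝ) < (n : ℝ) - 1 := by linarith
  have hL := charGap_one_pos hpb
  set L := charGap (b : ZMod p) 1 with hLd
  set ℓ := Real.log ((n : ℝ) - 1) with hℓ
  set T := ((n : ℝ) - 1) * ℓ / (2 * L) - c * (((n : ℝ) - 1) / L) with hT
  have hTe : T = ((n : ℝ) - 1) * (ℓ - 2 * c) / (2 * L) := by
    rw [hT]
    field_simp
  -- The heat kernel is a probability law only at nonnegative times; for fixed c the condition on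
  -- log(n-1) holds for large n.
  have hT0 : 0 ≤ T := by
    rw [hTe]
    have : 0 ≤ ℓ - 2 * c := by linarith
    positivity
  refine ⟨?_, tvDist_le_one (signedJumpDist_isProbDist hn _) hT0⟩
  refine le_trans (le_of_eq ?_) (le_tvDist_signedJumpDist hn (b : ZMod p) hL hT0)
  have e1 : 2 * (T / ((n : ℝ) - 1)) * L = ℓ - 2 * c := by
    rw [hTe]
    field_simp
  rw [← hLd, e1]
  have e2 : ((n : ℝ) - 1) * Real.exp (-(ℓ - 2 * c)) = Real.exp (2 * c) := by
    rw [neg_sub, Real.exp_sub, hℓ, Real.exp_log hn']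
    field_simp
  rw [e2, Real.exp_neg, div_eq_mul_inv]

/-- The cutoff time divided by the window (n-1)/L is log(n-1)/2, which does not involve p or b. This
is why p may vary with n arbitrarily. -/
theorem exhibitsCutoff_signedJumpDist (p b : ℕ → ℕ) [∀ n, NeZero (p n)]
    (hpb : ∀ n, 1 ≤ n → AdmissibleJump (p n) (b n)) (d : ℕ → ℝ → ℝ)
    (hd : ∀ n, 1 ≤ n → d n = tvDist (signedJumpDist n (p n) (b n : ZMod (p n)))) :
    ExhibitsCutoff d fun n => ((n : ℝ) - 1) * Real.log ((n : ℝ) - 1) /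
      (2 * charGap (b n : ZMod (p n)) 1) := by
  -- The value 1 for n < 2 only secures positivity of the window.
  set w : ℕ → ℝ := fun n => if 2 ≤ n then ((n : ℝ) - 1) / charGap (b n : ZMod (p n)) 1 else 1
    with hw
  have hwn : ∀ n, 2 ≤ n → w n = ((n : ℝ) - 1) / charGap (b n : ZMod (p n)) 1 := fun n hn =>
    if_pos hn
  have hlog : Tendsto (fun n : ℕ => Real.log ((n : ℝ) - 1)) atTop atTop :=
    Real.tendsto_log_atTop.comp (tendsto_atTop_add_const_right _ (-1) tendsto_natCast_atTop_atTop)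
  have hexp : Tendsto (fun c : ℝ => Real.exp (-(2 * c))) atTop (𝓝 0) :=
    Real.tendsto_exp_neg_atTop_nhds_zero.comp (tendsto_id.const_mul_atTop two_pos)
  refine exhibitsCutoff_of_bounds (w := w) (lo := fun c => 1 - 8 * Real.exp (-(2 * c)))
    (up := fun c => Real.exp (-(2 * c)) + (1 / 2) * Real.sqrt (Real.exp
      (2 / (1 - Real.exp (-(1 / 20))) * Real.exp (-(2 * c))) - 1)) ?_ ?_ ?_ ?_ ?_ ?_
  · intro n
    by_cases hn : 2 ≤ n
    · rw [hwn n hn]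
      have := charGap_one_pos (hpb n (by omega))
      have : (2 : ℝ) ≤ n := by exact_mod_cast hn
      exact div_pos (by linarith) (by assumption)
    · simp [hw, hn]
  · rw [Asymptotics.isLittleO_iff]
    intro ε hε
    filter_upwards [eventually_ge_atTop 2, hlog.eventually_ge_atTop (2 / ε)] with n hn hl
    rw [hwn n hn]
    have hL := charGap_one_pos (hpb n (by omega))
    have hn' : (0 : ℝ) < (n : ℝ) - 1 := by
      have : (2 : ℝ) ≤ n := by exact_mod_cast hn
      linarith
    have hl0 : 0 ≤ Real.log ((n : ℝ) - 1) := le_trans (by positivity) hl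
    rw [Real.norm_of_nonneg (by positivity), Real.norm_of_nonneg (by positivity)]
    rw [div_le_iff₀ hε] at hl
    have e : ε * (((n : ℝ) - 1) * Real.log ((n : ℝ) - 1) /
        (2 * charGap (b n : ZMod (p n)) 1)) = ((n : ℝ) - 1) / charGap (b n : ZMod (p n)) 1 *
        (Real.log ((n : ℝ) - 1) * ε / 2) := by
      field_simp
    rw [e]
    exact le_mul_of_one_le_right (by positivity) (by linarith)
  · simpa using (hexp.const_mul 8).const_sub 1
  · have h1 : Tendsto (fun c : ℝ => Real.exp (-(2 * c)) + (1 / 2) * Real.sqrt (Real.exp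
        (2 / (1 - Real.exp (-(1 / 20))) * Real.exp (-(2 * c))) - 1)) atTop
        (𝓝 (0 + (1 / 2) * Real.sqrt (Real.exp
          (2 / (1 - Real.exp (-(1 / 20))) * 0) - 1))) := by
      refine hexp.add (Tendsto.const_mul _ ?_)
      refine (Real.continuous_sqrt.tendsto _).comp (Tendsto.sub_const ?_ 1)
      exact (Real.continuous_exp.tendsto _).comp (hexp.const_mul _)
    simpa using h1
  · refine Eventually.of_forall fun c => ?_
    filter_upwards [eventually_ge_atTop 2, hlog.eventually_ge_atTop (2 * c)] with n hn hl
    rw [hd n (by omega), hwn n hn]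
    exact le_tvDist_signedJumpDist_of_admissible hn (hpb n (by omega)) hl
  · filter_upwards [eventually_ge_atTop 1] with c hc
    filter_upwards [eventually_ge_atTop 2] with n hn
    rw [hd n (by omega), hwn n hn]
    exact ⟨tvDist_nonneg _ _, tvDist_signedJumpDist_le_of_admissible hn (hpb n (by omega)) hc⟩

end Cutoff

theorem corollary1p2 (p : ℕ → ℕ) [∀ n, NeZero (p n)] (hp : ∀ n, 1 ≤ n → 6 ≤ p n) :
    ExhibitsCutoff (fun n => tvDist (jumpMu n (p n)))
      (fun n => ((n : ℝ) - 1) * Real.log ((n : ℝ) - 1) /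
        (2 * (1 - Real.cos (2 * Real.pi / (p n : ℝ))))) ∧
    ExhibitsCutoff (fun n => tvDist (jumpNu n (p n)))
      (fun n => ((n : ℝ) - 1) * Real.log ((n : ℝ) - 1) /
        ((1 - Real.cos (2 * Real.pi / (p n : ℝ))) +
          (1 - Real.cos (2 * Real.pi * (jumpSize (p n) : ℝ) / (p n : ℝ))))) := by
  constructor
  · have h := exhibitsCutoff_signedJumpDist p (fun _ => 1)
      (fun n hn => admissibleJump_one (hp n hn)) (fun n => tvDist (jumpMu n (p n)))
      (fun n hn => by rw [jumpMu_eq ((by norm_num : 3 ≤ 6).trans (hp n hn)), Nat.cast_one])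
    -- For b = 1 the two cosine terms of twice the gap coincide, which gives the denominator 2(1 -
    -- cos(2π/p)).
    simp_rw [two_mul_charGap_one, Nat.cast_one, mul_one, ← two_mul] at h
    exact h
  · have h := exhibitsCutoff_signedJumpDist p (fun n => jumpSize (p n))
      (fun n hn => admissibleJump_jumpSize (hp n hn)) (fun n => tvDist (jumpNu n (p n)))
      (fun n _ => by rw [jumpNu_eq])
    simp_rw [two_mul_charGap_one] at h
    exact h
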